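/- For an irrational real $\alpha$ let $\alpha=[a_0;a_1,a_2,\ldots]$ be its continued fraction expansion, $p_k/q_k=[a_0;a_1,\ldots,a_k]$ its convergents (in lowest terms, $q_k\ge 1$), and $s_K=\sum_{k=1}^{K}a_k$. Let $\{x\}$ denote the fractional part of $x$ and $\mathbf 1_{\{\cdot\}}$ an indicator. In the error terms, that is, inside $O(\cdot)$, $\log x$ means $\log\max\{e,x\}$. Let $c>0$ be an arbitrary constant. For every irrational $\alpha$, every integer $K\ge 0$ and every integer $N$ with $q_K\le N<q_{K+1}$, \[ \sum_{\substack{1\le n\le N\\ \{n\alpha\}\ge c/N}}\frac{1}{\{n\alpha\}} = N\log N+O\left(\left(\mathbf 1_{\{K+1\text{ odd}\}}\,a_{K+1}^{1/2}+\log s_{K+1}\right)N\right). \] If in addition $4(c\,a_{K+1})^{1/2}q_K\le N$ and $K+1$ is odd, then \[ \sum_{\substack{1\le n\le N\\ \{n\alpha\}\ge c/N}}\frac{1}{\{n\alpha\}} \ge N\log N+q_{K+1}-O\left((\log s_{K+1})N\right). \] The implied constants depend only on $c$. Further, for every irrational $\alpha$, every integer $K\ge 0$ and every integer $N$ with $q_K\le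 N<q_{K+1}$, \[ \sum_{n=1}^{N}\frac{1}{n\{n\alpha\}} = \frac12(\log N)^2+\frac{\pi^2}{6}\sum_{\substack{1\le k\le K\\ k\text{ odd}}}a_k+\mathbf 1_{\{K+1\text{ odd}\}}\,a_{K+1}\sum_{1\le j\le N/q_K}\frac1{j^2}+O\left(\sum_{\substack{1\le k\le K+1\\ k\text{ odd}}}a_k^{1/2}\log a_k+(\log s_{K+1})\log N\right) \] with a universal implied constant. -/

import Mathlib

/-- The partial quotient `a_k` of the continued fraction `α = [a_0; a_1, a_2, …]`, as a real number
(for irrational `α` the expansion is infinite and the default value `0` is never used). -/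
noncomputable def partialQuotient (α : ℝ) : ℕ → ℝ
  | 0 => (GenContFract.of α).h
  | k + 1 => ((GenContFract.of α).partDens.get? k).getD 0

/-- The denominator `q_k` of the convergent `p_k / q_k = [a_0; a_1, …, a_k]`. -/
noncomputable def convergentDen (α : ℝ) (k : ℕ) : ℝ :=
  (GenContFract.of α).dens k

/-- `s_K = a_1 + a_2 + ⋯ + a_K`. -/
noncomputable def partialQuotientSum (α : ℝ) (K : ℕ) : ℝ :=
  ∑ k ∈ Finset.Icc 1 K, partialQuotient α k

/-- The logarithm of error terms, `log (max {e, x})`. -/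
noncomputable def errLog (x : ℝ) : ℝ :=
  Real.log (max (Real.exp 1) x)

/-- The sum of `1 / {n α}` over those `1 ≤ n ≤ N` for which `{n α} ≥ c / N`. -/
noncomputable def fractSum (c α : ℝ) (N : ℕ) : ℝ :=
  ∑ n ∈ (Finset.Icc 1 N).filter (fun n : ℕ => c / (N : ℝ) ≤ Int.fract ((n : ℝ) * α)),
    1 / Int.fract ((n : ℝ) * α)

/-- The sum of `1 / (n {n α})` over `1 ≤ n ≤ N`. -/
noncomputable def weightedFractSum (α : ℝ) (N : ℕ) : ℝ :=
  ∑ n ∈ Finset.Icc 1 N, 1 / ((n : ℝ) * Int.fract ((n : ℝ) * α))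

/-! Fix `q_K ≤ N < q_{K+1}` and put `e = |q_K α - p_K|`, which lies between `1/(q_{K+1} + q_K)` and
`1/q_{K+1}`. Terms with `{nα} ≥ 1/q_K` give the main term, and those with `{nα} < 1/q_K` are known
explicitly.

Main term: `1/{nα}` is replaced by `q_K/(⌊q_K{nα}⌋ + 1)` at cost `O(N)`, and Abel summation turns
this into counts of `{nα} < j/q_K` weighted by `1/(j(j+1))`. Such a count is `Nj/q_K` up to
`O(s_{K+1})` (split `N` into blocks of convergent length) and also up to `O(Nj/q_K)` (use blocks of
length `q_K` only). Using the second bound for `j < s_{K+1}` and the first beyond leaves an error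
`O(N log s_{K+1})`; moreover `N ∑_{j ≤ q_K} 1/j` is `N log N` to the same accuracy because `N/q_K ≤
2 s_{K+1}`. This is `abs_sum_one_le_mul_fract_sub_le`.

Exceptional terms: for even `K` they are exactly `n = j q_K`, with `{nα} = je`. The cutoff `je ≥
c/N` bounds their sum by a multiple of `√a_{K+1} N`; conversely, if the range of `j` left by the
cutoff is long enough, their sum is at least `1/e ≥ q_{K+1}`. For odd `K` they lie in the class of
`q_{K+1}` modulo `q_K`, and contribute only `O(N log s_{K+1})`.

Weighted sum: on each block `q_k ≤ n < q_{k+1}`, partial summation applied to the sum without the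
multiples of `q_k` (`k` even) gives the increment of `(log n)²/2`. The multiples give `(q_k e)⁻¹ ∑
1/j²`, with `e` taken at index `k` and `(q_k e)⁻¹ = a_{k+1} + O(1)`; over a complete block this is
`(π²/6) a_{k+1} + O(1)`. The block errors add up to `O(log s_{K+1} log N)` because the number of
blocks is `O(1 + log N)`. -/

/-! ### Continued fraction data of an irrational number -/

/-- `a`, `q`, `p` are the partial quotients, denominators and numerators of a real number `α` with
an infinite continued fraction expansion, recorded through the inequalities used below. -/
structure IsConvergentSeq (α : ℝ) (a q : ℕ → ℕ) (p : ℕ → ℤ) : Prop where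
  den_zero : q 0 = 1
  one_le_quot (k : ℕ) : 1 ≤ a (k + 1)
  quot_mul_den_le (k : ℕ) : a (k + 1) * q k ≤ q (k + 1)
  den_succ_le (k : ℕ) : q (k + 1) ≤ (a (k + 1) + 1) * q k
  den_add_le (k : ℕ) : q k + q (k + 1) ≤ q (k + 2)
  det (k : ℕ) : p k * q (k + 1) - p (k + 1) * q k = (-1) ^ (k + 1)
  dist_le (k : ℕ) : (-1) ^ k * (q k * α - p k) ≤ 1 / (q (k + 1) : ℝ)
  le_dist (k : ℕ) : 1 / ((q (k + 1) : ℝ) + q k) ≤ (-1) ^ k * (q k * α - p k)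

-- Irrationality rules out termination, so every partial denominator is a positive integer and the
-- continuants are integers satisfying the usual recurrence. The two distance bounds come from the
-- exact formula for the approximation error in terms of the complete quotient.
open GenContFract in
theorem exists_isConvergentSeq {α : ℝ} (hα : Irrational α) :
    ∃ (a q : ℕ → ℕ) (p : ℕ → ℤ), IsConvergentSeq α a q p ∧
      (∀ k, convergentDen α k = q k) ∧ (∀ k, partialQuotient α (k + 1) = a (k + 1)) := by
  have hnt : ∀ n, ¬ (GenContFract.of α).TerminatedAt n := by
    intro n hn
    obtain ⟨r, hr⟩ := (terminates_iff_rat α).1 ⟨n, hn⟩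
    exact hα ⟨r, hr.symm⟩
  have hgp : ∀ n, ∃ b : ℕ, 1 ≤ b ∧ (GenContFract.of α).s.get? n = some ⟨1, (b : ℝ)⟩ := by
    intro n
    obtain ⟨gp, hs⟩ : ∃ gp, (GenContFract.of α).s.get? n = some gp :=
      Option.ne_none_iff_exists'.1 (hnt n)
    obtain ⟨h1, z, hz⟩ := of_partNum_eq_one_and_exists_int_partDen_eq hs
    have h2 : (1 : ℝ) ≤ gp.b := of_one_le_get?_partDen (partDen_eq_s_b hs)
    rw [hz] at h2
    have h3 : 1 ≤ z := by exact_mod_cast h2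
    lift z to ℕ using by omega
    refine ⟨z, by exact_mod_cast h3, ?_⟩
    rw [hs]
    cases gp
    simp_all
  choose b hb1 hb using hgp
  set g := GenContFract.of α with hg
  have hrec : ∀ n, g.contsAux (n + 2) =
      ⟨b n * (g.contsAux (n + 1)).a + (g.contsAux n).a,
        b n * (g.contsAux (n + 1)).b + (g.contsAux n).b⟩ := by
    intro n
    rw [contsAux_recurrence (hb n) rfl rfl]
    simp
  have hq : ∀ n, ∃ m : ℕ, (g.contsAux n).b = m := by
    have : ∀ n, (∃ m : ℕ, (g.contsAux n).b = m) ∧ ∃ m : ℕ, (g.contsAux (n + 1)).b = m := by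
      intro n
      induction n with
      | zero => exact ⟨⟨0, by simp⟩, ⟨1, by simp⟩⟩
      | succ n ih =>
        obtain ⟨⟨m, hm⟩, m', hm'⟩ := ih
        refine ⟨⟨m', hm'⟩, b n * m' + m, ?_⟩
        rw [hrec, hm, hm']
        push_cast
        rfl
    exact fun n => (this n).1
  have hp : ∀ n, ∃ m : ℤ, (g.contsAux n).a = m := by
    have : ∀ n, (∃ m : ℤ, (g.contsAux n).a = m) ∧ ∃ m : ℤ, (g.contsAux (n + 1)).a = m := by
      intro n
      induction n with
      | zero => exact ⟨⟨1, by simp⟩, ⟨⌊α⌋, by simp [hg, of_h_eq_floor]⟩⟩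
      | succ n ih =>
        obtain ⟨⟨m, hm⟩, m', hm'⟩ := ih
        refine ⟨⟨m', hm'⟩, b n * m' + m, ?_⟩
        rw [hrec, hm, hm']
        push_cast
        rfl
    exact fun n => (this n).1
  choose Q hQ using hq
  choose P hP using hp
  have hQ0 : Q 0 = 0 := by have := hQ 0; simp at this; exact_mod_cast this.symm
  have hQ1 : Q 1 = 1 := by have := hQ 1; simp at this; exact_mod_cast this.symm
  have hQr : ∀ n, Q (n + 2) = b n * Q (n + 1) + Q n := by
    intro n
    have := hQ (n + 2)
    rw [hrec, hQ, hQ] at this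
    simp only at this
    exact_mod_cast this.symm
  have hP0 : P 0 = 1 := by have := hP 0; simp at this; exact_mod_cast this.symm
  have hPr : ∀ n, P (n + 2) = b n * P (n + 1) + P n := by
    intro n
    have := hP (n + 2)
    rw [hrec, hP, hP] at this
    simp only at this
    exact_mod_cast this.symm
  have hle : ∀ n, Q n ≤ Q (n + 1) := by
    intro n
    cases n with
    | zero => omega
    | succ n => rw [hQr]; nlinarith [hb1 n]
  have hpos : ∀ n, 1 ≤ Q (n + 1) := by
    intro n
    induction n with
    | zero => exact hQ1.ge
    | succ n ih => exact ih.trans (hle _)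
  have hdet : ∀ n, P n * Q (n + 1) - P (n + 1) * Q n = (-1) ^ n := by
    intro n
    induction n with
    | zero => simp [hP0, hQ0, hQ1]
    | succ n ih =>
      rw [hQr, hPr, pow_succ, ← ih]
      push_cast
      ring
  -- Here `x` is the complete quotient, the inverse of the fractional part at stage `n`, so its
  -- integer part is `b n`.
  have hmain : ∀ n, ∃ x : ℝ, (b n : ℝ) ≤ x ∧ x ≤ b n + 1 ∧
      (-1) ^ n * (Q (n + 1) * α - P (n + 1)) = 1 / (x * Q (n + 1) + Q n) := by
    intro n
    obtain ⟨f', hf', hfb⟩ := IntFractPair.exists_succ_get?_stream_of_gcf_of_get?_eq_some (hb n)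
    obtain ⟨f, hf, hf0, rfl⟩ := IntFractPair.succ_nth_stream_eq_some_iff.1 hf'
    have h := sub_convs_eq hf
    simp only [← hg, hf0, if_false] at h
    rw [conv_eq_conts_a_div_conts_b, nth_cont_eq_succ_nth_contAux, hQ, hQ, hP] at h
    have hfb' : ((⌊f.fr⁻¹⌋ : ℤ) : ℝ) = b n := hfb
    refine ⟨f.fr⁻¹, ?_, ?_, ?_⟩
    · rw [← hfb']; exact Int.floor_le _
    · rw [← hfb']; exact (Int.lt_floor_add_one _).le
    · have h1 : (0 : ℝ) < Q (n + 1) := by exact_mod_cast hpos n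
      have h2 : (0 : ℝ) < f.fr⁻¹ := by
        have : (1 : ℝ) ≤ b n := by exact_mod_cast hb1 n
        have := Int.floor_le f.fr⁻¹
        linarith
      have h3 : (0 : ℝ) < f.fr⁻¹ * Q (n + 1) + Q n := by positivity
      have h4 : (Q (n + 1) * α - P (n + 1) : ℝ) = Q (n + 1) * (α - P (n + 1) / Q (n + 1)) := by
        field_simp
      have h5 : ((-1 : ℝ) ^ n) * (-1) ^ n = 1 := by rw [← mul_pow]; simp
      rw [h4, h, show ∀ s D y : ℝ, s * (D * (s / (D * y))) = s * s * (D * (1 / (D * y))) by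
        intros; ring, h5, one_mul]
      field_simp
  -- The auxiliary continuants start one step early, at `(1, 0)`, hence the shift by one. The value
  -- at `k = 0` of the quotient sequence is a dummy.
  refine ⟨fun k => b (k - 1), fun k => Q (k + 1), fun k => P (k + 1), ?_, ?_, ?_⟩
  · refine ⟨hQ1, fun k => hb1 k, ?_, ?_, ?_, ?_, ?_, ?_⟩
    · intro k
      simp only [Nat.add_sub_cancel]
      rw [hQr]; omega
    · intro k
      simp only [Nat.add_sub_cancel]
      rw [hQr]; nlinarith [hle k]
    · intro k
      rw [hQr (k + 1)]; nlinarith [hb1 (k + 1)]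
    · intro k
      exact hdet (k + 1)
    · intro k
      obtain ⟨x, h1, h2, h3⟩ := hmain k
      rw [h3]
      have h4 : (Q (k + 1 + 1) : ℝ) = b k * Q (k + 1) + Q k := by exact_mod_cast hQr k
      have h0 : (0 : ℝ) < Q (k + 1 + 1) := by exact_mod_cast hpos (k + 1)
      apply one_div_le_one_div_of_le h0
      rw [h4]
      gcongr
    · intro k
      obtain ⟨x, h1, h2, h3⟩ := hmain k
      rw [h3]
      have h4 : (Q (k + 1 + 1) : ℝ) = b k * Q (k + 1) + Q k := by exact_mod_cast hQr k
      have h0 : (0 : ℝ) < Q (k + 1) := by exact_mod_cast hpos k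
      have h5 : (1 : ℝ) ≤ b k := by exact_mod_cast hb1 k
      apply one_div_le_one_div_of_le
      · nlinarith [(Nat.cast_nonneg (Q k) : (0 : ℝ) ≤ Q k)]
      · rw [h4]
        nlinarith
  · intro k
    rw [convergentDen, den_eq_conts_b, nth_cont_eq_succ_nth_contAux, hQ]
  · intro k
    rw [partialQuotient, partDen_eq_s_b (hb k)]
    simp

namespace IsConvergentSeq

variable {α : ℝ} {a q : ℕ → ℕ} {p : ℕ → ℤ}

theorem den_le_succ (h : IsConvergentSeq α a q p) (k : ℕ) : q k ≤ q (k + 1) :=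
  (Nat.le_mul_of_pos_left _ (h.one_le_quot k)).trans (h.quot_mul_den_le k)

theorem den_pos (h : IsConvergentSeq α a q p) (k : ℕ) : 0 < q k := by
  induction k with
  | zero => simp [h.den_zero]
  | succ k ih => exact ih.trans_le (h.den_le_succ k)

theorem isCoprime (h : IsConvergentSeq α a q p) (k : ℕ) : IsCoprime (p k) (q k : ℤ) := by
  have hd := h.det k
  have h1 : ((-1 : ℤ) ^ (k + 1)) * (-1) ^ (k + 1) = 1 := by rw [← mul_pow]; simp
  refine ⟨(-1) ^ (k + 1) * q (k + 1), -((-1) ^ (k + 1) * p (k + 1)), ?_⟩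
  linear_combination (-1) ^ (k + 1) * hd + h1

theorem dist_pos (h : IsConvergentSeq α a q p) (k : ℕ) :
    0 < (-1) ^ k * (q k * α - p k) := by
  refine lt_of_lt_of_le ?_ (h.le_dist k)
  have h1 : (0 : ℝ) < q k := by exact_mod_cast h.den_pos k
  positivity

end IsConvergentSeq

/-! ### Counting multiples of `α` in arcs -/

open Finset

/-- Among `q` consecutive multiples of `α`, where `α` is within `1 / q ^ 2` of a reduced fraction
`p / q`, an arc of length `(v - u) / q` receives at most `v - u + 2`. -/
theorem card_filter_mul_fract_mem_Ico_le {α : ℝ} {q : ℕ} {p : ℤ} (hq : 0 < q)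
    (hpq : IsCoprime p (q : ℤ)) (hα : |(q : ℝ) * α - p| ≤ 1 / q) (A : ℕ) {u v : ℝ} (huv : u ≤ v) :
    (#{n ∈ Ioc A (A + q) | u ≤ q * Int.fract ((n : ℕ) * α) ∧ q * Int.fract ((n : ℕ) * α) < v} : ℝ)
      ≤ v - u + 2 := by
  set d : ℝ := (q : ℝ) * α - p with hd
  have hq' : (0 : ℝ) < q := by exact_mod_cast hq
  -- The integer `z n` is congruent to `np` modulo `q`, so it is injective on `q` consecutive `n`.
  -- It differs from `q{nα}` by the drift `nd`, which varies by at most `q|d| ≤ 1` over the block.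
  -- Hence the `z n` are distinct integers in an interval of length `v - u + 1`.
  let z : ℕ → ℤ := fun n => n * p - q * ⌊(n : ℝ) * α⌋
  have hz : ∀ n : ℕ, (z n : ℝ) = q * Int.fract ((n : ℝ) * α) - n * d := by
    intro n
    simp only [z, Int.fract, hd]
    push_cast
    ring
  have hinj : Set.InjOn z (Ioc A (A + q) : Set ℕ) := by
    intro n hn m hm hnm
    simp only [coe_Ioc, Set.mem_Ioc] at hn hm
    have h1 : (q : ℤ) ∣ ((n : ℤ) - m) * p := by
      refine ⟨⌊(n : ℝ) * α⌋ - ⌊(m : ℝ) * α⌋, ?_⟩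
      simp only [z] at hnm
      linear_combination hnm
    have h2 : (q : ℤ) ∣ (n : ℤ) - m := hpq.symm.dvd_of_dvd_mul_right h1
    have h3 := Int.eq_zero_of_abs_lt_dvd h2 (by rw [abs_lt]; constructor <;> omega)
    omega
  have hmaps : ∀ {l : ℝ}, (∀ n : ℕ, A < n → n ≤ A + q → u ≤ q * Int.fract ((n : ℝ) * α) →
      q * Int.fract ((n : ℝ) * α) < v → l ≤ z n ∧ (z n : ℝ) ≤ l + (v - u + 1)) →
      (#{n ∈ Ioc A (A + q) | u ≤ q * Int.fract ((n : ℕ) * α) ∧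
        q * Int.fract ((n : ℕ) * α) < v} : ℝ) ≤ v - u + 2 := by
    intro l hl
    have hc : #{n ∈ Ioc A (A + q) | u ≤ q * Int.fract ((n : ℕ) * α) ∧
        q * Int.fract ((n : ℕ) * α) < v} ≤ #(Icc ⌈l⌉ ⌊l + (v - u + 1)⌋) := by
      refine card_le_card_of_injOn z ?_ (hinj.mono (coe_subset.2 (filter_subset _ _)))
      intro n hn
      simp only [mem_coe, mem_filter, mem_Ioc] at hn
      obtain ⟨h1, h2⟩ := hl n hn.1.1 hn.1.2 hn.2.1 hn.2.2
      simp only [coe_Icc, Set.mem_Icc]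
      exact ⟨Int.ceil_le.2 h1, Int.le_floor.2 h2⟩
    rw [Int.card_Icc] at hc
    have h1 : ((⌊l + (v - u + 1)⌋ + 1 - ⌈l⌉).toNat : ℝ) ≤ v - u + 2 := by
      have h2 : (((⌊l + (v - u + 1)⌋ + 1 - ⌈l⌉).toNat : ℤ) : ℝ) ≤ v - u + 2 := by
        rw [Int.toNat_eq_max]
        push_cast
        apply max_le
        · have := Int.floor_le (l + (v - u + 1))
          have := Int.le_ceil l
          linarith
        · linarith
      exact_mod_cast h2
    exact le_trans (by exact_mod_cast hc) h1
  have hshift : ∀ n : ℕ, A < n → n ≤ A + q → 0 ≤ ((n : ℝ) - A) ∧ ((n : ℝ) - A) ≤ q := by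
    intro n h1 h2
    have h1' : (A : ℝ) < n := by exact_mod_cast h1
    have h2' : (n : ℝ) ≤ A + q := by exact_mod_cast h2
    constructor <;> linarith
  have hqd : q * |d| ≤ 1 := by
    calc (q : ℝ) * |d| ≤ q * (1 / q) := by gcongr
      _ = 1 := by field_simp
  -- The sign of `d` decides on which side the drift widens the interval.
  rcases le_total 0 d with h0 | h0
  · rw [abs_of_nonneg h0] at hqd
    refine hmaps (l := u - A * d - 1) fun n h1 h2 h3 h4 => ?_
    obtain ⟨h5, h6⟩ := hshift n h1 h2
    rw [hz]
    constructor <;> nlinarith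
  · rw [abs_of_nonpos h0] at hqd
    refine hmaps (l := u - A * d) fun n h1 h2 h3 h4 => ?_
    obtain ⟨h5, h6⟩ := hshift n h1 h2
    rw [hz]
    constructor <;> nlinarith

/-- The number of `A < n ≤ A + M` with `{n α} < x`. -/
noncomputable def fractCount (α : ℝ) (A M : ℕ) (x : ℝ) : ℕ :=
  #{n ∈ Ioc A (A + M) | Int.fract ((n : ℕ) * α) < x}

theorem fractCount_add (α : ℝ) (A M M' : ℕ) (x : ℝ) :
    fractCount α A (M + M') x = fractCount α A M x + fractCount α (A + M) M' x := by
  unfold fractCount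
  rw [← card_union_of_disjoint, ← filter_union]
  · congr 2
    rw [Ioc_union_Ioc_eq_Ioc (by omega) (by omega), add_assoc]
  · refine disjoint_filter_filter (Finset.disjoint_left.2 fun n h1 h2 => ?_)
    simp only [mem_Ioc] at h1 h2
    omega

/-- The lower bound is the upper bound for the complementary arc, since the two counts add up to
`q`. -/
theorem abs_fractCount_den_sub_le {α : ℝ} {q : ℕ} {p : ℤ} (hq : 0 < q)
    (hpq : IsCoprime p (q : ℤ)) (hα : |(q : ℝ) * α - p| ≤ 1 / q) (A : ℕ) {x : ℝ} (hx : 0 ≤ x)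
    (hx1 : x ≤ 1) : |(fractCount α A q x : ℝ) - q * x| ≤ 2 := by
  have hq' : (0 : ℝ) < q := by exact_mod_cast hq
  have h1 := card_filter_mul_fract_mem_Ico_le hq hpq hα A (u := 0) (v := q * x) (by positivity)
  have h2 := card_filter_mul_fract_mem_Ico_le hq hpq hα A (u := q * x) (v := q) (by nlinarith)
  have e1 : {n ∈ Ioc A (A + q) | 0 ≤ q * Int.fract ((n : ℕ) * α) ∧
      q * Int.fract ((n : ℕ) * α) < q * x} = {n ∈ Ioc A (A + q) | Int.fract ((n : ℕ) * α) < x} := by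
    apply filter_congr
    intro n _
    have := Int.fract_nonneg ((n : ℝ) * α)
    constructor
    · rintro ⟨_, h⟩
      exact lt_of_mul_lt_mul_left h hq'.le
    · intro h
      exact ⟨by positivity, by gcongr⟩
  have e2 : {n ∈ Ioc A (A + q) | q * x ≤ q * Int.fract ((n : ℕ) * α) ∧
      q * Int.fract ((n : ℕ) * α) < q} =
      {n ∈ Ioc A (A + q) | ¬ Int.fract ((n : ℕ) * α) < x} := by
    apply filter_congr
    intro n _
    have := Int.fract_lt_one ((n : ℝ) * α)
    rw [not_lt]
    constructor
    · rintro ⟨h, _⟩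
      exact le_of_mul_le_mul_left h hq'
    · intro h
      exact ⟨by gcongr, by nlinarith⟩
  rw [e1] at h1
  rw [e2] at h2
  have h3 := card_filter_add_card_filter_not (s := Ioc A (A + q))
    (fun n : ℕ => Int.fract ((n : ℕ) * α) < x)
  rw [Nat.card_Ioc, Nat.add_sub_cancel_left] at h3
  have h4 : (#{n ∈ Ioc A (A + q) | Int.fract ((n : ℕ) * α) < x} : ℝ)
    + #{n ∈ Ioc A (A + q) | ¬ Int.fract ((n : ℕ) * α) < x} = q := by exact_mod_cast h3
  unfold fractCount
  rw [abs_le]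
  constructor <;> linarith

theorem abs_fractCount_den_mul_sub_le {α : ℝ} {q : ℕ} {p : ℤ} (hq : 0 < q)
    (hpq : IsCoprime p (q : ℤ)) (hα : |(q : ℝ) * α - p| ≤ 1 / q) (A b : ℕ) {x : ℝ} (hx : 0 ≤ x)
    (hx1 : x ≤ 1) : |(fractCount α A (q * b) x : ℝ) - (q * b : ℕ) * x| ≤ 2 * b := by
  induction b with
  | zero => simp [fractCount]
  | succ b ih =>
    rw [mul_add, mul_one, fractCount_add]
    have h1 := abs_fractCount_den_sub_le hq hpq hα (A + q * b) hx hx1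
    push_cast at ih ⊢
    rw [abs_le] at *
    constructor <;> linarith

namespace IsConvergentSeq

variable {α : ℝ} {a q : ℕ → ℕ} {p : ℕ → ℤ}

theorem abs_dist_le (h : IsConvergentSeq α a q p) (k : ℕ) :
    |(q k : ℝ) * α - p k| ≤ 1 / (q (k + 1) : ℝ) := by
  have h1 := h.dist_le k
  rw [← abs_of_pos (h.dist_pos k), abs_mul, abs_pow] at h1
  simpa using h1

theorem abs_dist_le_one_div_den (h : IsConvergentSeq α a q p) (k : ℕ) :
    |(q k : ℝ) * α - p k| ≤ 1 / (q k : ℝ) := by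
  refine (h.abs_dist_le k).trans (one_div_le_one_div_of_le ?_ ?_)
  · exact_mod_cast h.den_pos k
  · exact_mod_cast h.den_le_succ k

/-- Greedy (Ostrowski) splitting: `M < q_{k+1}` consists of at most `a_{k+1}` blocks of length
`q_k`, each with error at most `2`, and a remainder shorter than `q_k`. -/
theorem abs_fractCount_sub_le (h : IsConvergentSeq α a q p) (k A M : ℕ) (hM : M < q k)
    {x : ℝ} (hx : 0 ≤ x) (hx1 : x ≤ 1) :
    |(fractCount α A M x : ℝ) - M * x| ≤ 2 * ∑ i ∈ Icc 1 k, (a i : ℝ) := by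
  induction k generalizing M A with
  | zero =>
    have : M = 0 := by have := h.den_zero; omega
    simp [this, fractCount]
  | succ k ih =>
    rw [sum_Icc_succ_top (by omega)]
    have h1 := ih (A + q k * (M / q k)) (M % q k) (Nat.mod_lt _ (h.den_pos k))
    have h2 := abs_fractCount_den_mul_sub_le (h.den_pos k) (h.isCoprime k)
      (h.abs_dist_le_one_div_den k) A (M / q k) hx hx1
    have h3 : ((M / q k : ℕ) : ℝ) ≤ a (k + 1) := by
      have : M / q k < a (k + 1) + 1 := by
        rw [Nat.div_lt_iff_lt_mul (h.den_pos k)]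
        exact hM.trans_le (h.den_succ_le k)
      exact_mod_cast Nat.lt_succ_iff.1 this
    have h4 := fractCount_add α A (q k * (M / q k)) (M % q k) x
    rw [Nat.div_add_mod] at h4
    have h5 : (M : ℝ) = (q k * (M / q k) : ℕ) + (M % q k : ℕ) := by
      exact_mod_cast (Nat.div_add_mod M (q k)).symm
    rw [h4, h5]
    push_cast at *
    rw [abs_le] at *
    constructor <;> linarith

/-- Counting in an arc with blocks of length `q k`. -/
theorem card_filter_mul_fract_le (h : IsConvergentSeq α a q p) {k N : ℕ} (hN : q k ≤ N)
    {u v : ℝ} (huv : u ≤ v) :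
    (#{n ∈ Icc 1 N | u ≤ q k * Int.fract ((n : ℕ) * α) ∧ q k * Int.fract ((n : ℕ) * α) < v} : ℝ)
      ≤ 2 * (N / q k) * (v - u + 2) := by
  have hq := h.den_pos k
  have hq' : (0 : ℝ) < q k := by exact_mod_cast hq
  have key : ∀ b : ℕ, (#{n ∈ Ioc 0 (q k * b) | u ≤ q k * Int.fract ((n : ℕ) * α) ∧
      q k * Int.fract ((n : ℕ) * α) < v} : ℝ) ≤ b * (v - u + 2) := by
    intro b
    induction b with
    | zero => simp
    | succ b ih =>
      have h1 := card_filter_mul_fract_mem_Ico_le hq (h.isCoprime k)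
        (h.abs_dist_le_one_div_den k) (q k * b) huv
      rw [mul_add, mul_one, ← Ioc_union_Ioc_eq_Ioc (Nat.zero_le (q k * b)) (Nat.le_add_right _ _),
        filter_union]
      have h2 := card_union_le {n ∈ Ioc 0 (q k * b) | u ≤ q k * Int.fract ((n : ℕ) * α) ∧
          q k * Int.fract ((n : ℕ) * α) < v}
        {n ∈ Ioc (q k * b) (q k * b + q k) | u ≤ q k * Int.fract ((n : ℕ) * α) ∧
          q k * Int.fract ((n : ℕ) * α) < v}
      refine le_trans (Nat.cast_le.2 h2) ?_
      push_cast
      linarith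
  -- The range is covered by `⌊N/q_k⌋ + 1` blocks, at most `2N/q_k` because `q_k ≤ N`.
  have hsub : N ≤ q k * (N / q k + 1) := (Nat.lt_mul_div_succ N hq).le
  refine le_trans ?_ ((key (N / q k + 1)).trans ?_)
  · refine Nat.cast_le.2 (card_le_card (filter_subset_filter _ fun n hn => ?_))
    simp only [mem_Icc, mem_Ioc] at hn ⊢
    omega
  · refine mul_le_mul_of_nonneg_right ?_ (by linarith)
    have h1 : ((N / q k : ℕ) : ℝ) ≤ N / q k := Nat.cast_div_le
    have h2 : (1 : ℝ) ≤ N / q k := by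
      rw [le_div_iff₀ hq', one_mul]; exact_mod_cast hN
    push_cast
    linarith

end IsConvergentSeq

/-! ### Logarithms, harmonic sums and Abel summation -/

theorem one_le_errLog (x : ℝ) : 1 ≤ errLog x := by
  unfold errLog
  rw [Real.le_log_iff_exp_le (lt_max_of_lt_left (Real.exp_pos 1))]
  exact le_max_left _ _

theorem log_le_errLog {x : ℝ} (hx : 0 < x) : Real.log x ≤ errLog x :=
  Real.log_le_log hx (le_max_right _ _)

theorem errLog_mono {x y : ℝ} (hxy : x ≤ y) : errLog x ≤ errLog y :=
  Real.log_le_log (lt_max_of_lt_left (Real.exp_pos 1)) (max_le_max_left _ hxy)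

theorem sum_range_inv_le_one_add_log (n : ℕ) :
    ∑ j ∈ range n, 1 / ((j : ℝ) + 1) ≤ 1 + Real.log n := by
  have := harmonic_le_one_add_log n
  simpa [harmonic] using this

theorem log_le_sum_range_inv (n : ℕ) :
    Real.log (n + 1) ≤ ∑ j ∈ range n, 1 / ((j : ℝ) + 1) := by
  have := log_add_one_le_harmonic n
  simpa [harmonic] using this

theorem sum_Ico_inv_mul_succ {m n : ℕ} (hm : 0 < m) (hmn : m ≤ n) :
    ∑ j ∈ Ico m n, 1 / ((j : ℝ) * (j + 1)) = 1 / m - 1 / n := by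
  induction n, hmn using Nat.le_induction with
  | base => simp
  | succ n hn ih =>
    have h0 : (0 : ℝ) < n := by exact_mod_cast hm.trans_le hn
    rw [sum_Ico_succ_top hn, ih]
    push_cast
    field_simp
    ring

theorem sum_Ico_inv_mul_succ_le {m n : ℕ} (hm : 0 < m) :
    ∑ j ∈ Ico m n, 1 / ((j : ℝ) * (j + 1)) ≤ 1 / m := by
  rcases le_total m n with h | h
  · rw [sum_Ico_inv_mul_succ hm h]
    have : (0 : ℝ) ≤ 1 / n := by positivity
    linarith
  · rw [Ico_eq_empty_of_le h, sum_empty]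
    positivity

/-- Abel summation: `1/(g + 1) = 1/q + ∑_{g < j < q} 1/(j(j+1))` by telescoping, and then the two
sums are exchanged. -/
theorem sum_inv_succ_eq_sum_card {ι : Type*} (s : Finset ι) (g : ι → ℕ) {q : ℕ}
    (hg : ∀ n ∈ s, g n < q) :
    ∑ n ∈ s, 1 / ((g n : ℝ) + 1) =
      #s / q + ∑ j ∈ Ico 1 q, (#{n ∈ s | g n < j} : ℝ) * (1 / ((j : ℝ) * (j + 1))) := by
  have h1 : ∀ n ∈ s, 1 / ((g n : ℝ) + 1) =
      1 / q + ∑ j ∈ Ico 1 q, if g n < j then 1 / ((j : ℝ) * (j + 1)) else 0 := by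
    intro n hn
    rw [← sum_filter]
    have : (Ico 1 q).filter (fun j => g n < j) = Ico (g n + 1) q := by
      ext j
      simp only [mem_filter, mem_Ico]
      omega
    rw [this, sum_Ico_inv_mul_succ (by omega) (hg n hn)]
    push_cast
    ring
  rw [sum_congr rfl h1, sum_add_distrib, sum_const, sum_comm, nsmul_eq_mul, mul_one_div]
  congr 1
  refine sum_congr rfl fun j _ => ?_
  rw [← sum_filter, sum_const, nsmul_eq_mul]

/-- `a_1 + ⋯ + a_K`. -/
def quotSum (a : ℕ → ℕ) (K : ℕ) : ℕ := ∑ i ∈ Icc 1 K, a i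

theorem quotSum_mono (a : ℕ → ℕ) : Monotone (quotSum a) := fun _ _ h =>
  sum_le_sum_of_subset (Icc_subset_Icc_right h)

theorem quot_le_quotSum (a : ℕ → ℕ) (K : ℕ) : a (K + 1) ≤ quotSum a (K + 1) :=
  single_le_sum (f := a) (fun _ _ => Nat.zero_le _) (mem_Icc.2 ⟨by omega, le_rfl⟩)

/-! ### The main term: points with `{nα} ≥ 1/q_K` -/

namespace IsConvergentSeq

variable {α : ℝ} {a q : ℕ → ℕ} {p : ℕ → ℤ}

theorem one_le_quotSum (h : IsConvergentSeq α a q p) (K : ℕ) : 1 ≤ quotSum a (K + 1) :=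
  (h.one_le_quot K).trans (quot_le_quotSum a K)

theorem den_succ_le_two_mul_quotSum (h : IsConvergentSeq α a q p) (K : ℕ) :
    q (K + 1) ≤ 2 * quotSum a (K + 1) * q K := by
  refine (h.den_succ_le K).trans (Nat.mul_le_mul_right _ ?_)
  have := h.one_le_quotSum K
  have := quot_le_quotSum a K
  omega

theorem log_div_den_le (h : IsConvergentSeq α a q p) {K N : ℕ} (hN : 0 < N)
    (hN' : N ≤ q (K + 1)) :
    Real.log N - Real.log (q K) ≤ 2 * errLog (quotSum a (K + 1)) := by
  have hs : (0 : ℝ) < quotSum a (K + 1) := by exact_mod_cast h.one_le_quotSum K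
  have hq : (0 : ℝ) < q K := by exact_mod_cast h.den_pos K
  have h1 : Real.log N ≤ Real.log (2 * quotSum a (K + 1) * q K) := by
    apply Real.log_le_log (by exact_mod_cast hN)
    exact_mod_cast hN'.trans (h.den_succ_le_two_mul_quotSum K)
  rw [Real.log_mul (by positivity) (by positivity), Real.log_mul (by positivity) (by positivity)]
    at h1
  have h2 := log_le_errLog hs
  have h3 := one_le_errLog (quotSum a (K + 1))
  have h4 := Real.log_two_lt_d9
  linarith

/-- The first bound is uniform in `j` and serves for large `j`; the second, from blocks of length
`q_K` alone, is better for small `j`. -/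
theorem abs_fractCount_mul_sub_le (h : IsConvergentSeq α a q p) {K N : ℕ} (hN : q K ≤ N)
    (hN' : N < q (K + 1)) {j : ℕ} (hj : 1 ≤ j) (hjq : j ≤ q K) :
    |q K * (fractCount α 0 N (j / q K) : ℝ) - N * j| ≤ 2 * quotSum a (K + 1) * q K ∧
      |q K * (fractCount α 0 N (j / q K) : ℝ) - N * j| ≤ 6 * N * j := by
  have hq : (0 : ℝ) < q K := by exact_mod_cast h.den_pos K
  have hj' : (1 : ℝ) ≤ j := by exact_mod_cast hj
  constructor
  · have h1 := h.abs_fractCount_sub_le (K + 1) 0 N hN' (x := j / q K) (by positivity)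
      (by rw [div_le_one hq]; exact_mod_cast hjq)
    have h2 : q K * (fractCount α 0 N (j / q K) : ℝ) - N * j =
        q K * (fractCount α 0 N (j / q K) - N * (j / q K)) := by field_simp
    rw [h2, abs_mul, abs_of_pos hq]
    calc (q K : ℝ) * _ ≤ q K * (2 * ∑ i ∈ Icc 1 (K + 1), (a i : ℝ)) := by gcongr
      _ = _ := by rw [quotSum]; push_cast; ring
  · have h1 := h.card_filter_mul_fract_le hN (u := 0) (v := j) (by positivity)
    have h2 : fractCount α 0 N (j / q K) = #{n ∈ Icc 1 N | 0 ≤ q K * Int.fract ((n : ℕ) * α) ∧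
        q K * Int.fract ((n : ℕ) * α) < j} := by
      unfold fractCount
      rw [zero_add]
      have h0 : Ioc 0 N = Icc 1 N := by ext; simp; omega
      rw [h0]
      congr 1
      apply filter_congr
      intro n _
      have := Int.fract_nonneg ((n : ℝ) * α)
      rw [lt_div_iff₀ hq, mul_comm]
      exact ⟨fun h => ⟨by positivity, h⟩, fun h => h.2⟩
    rw [← h2] at h1
    have h3 : q K * (fractCount α 0 N (j / q K) : ℝ) ≤ 2 * N * (j - 0 + 2) := by
      calc _ ≤ q K * (2 * (N / q K) * ((j : ℝ) - 0 + 2)) := by gcongr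
        _ = _ := by field_simp
    have h4 : (0 : ℝ) ≤ q K * (fractCount α 0 N (j / q K) : ℝ) := by positivity
    have h5 : (0 : ℝ) ≤ N := by positivity
    rw [abs_le]
    constructor <;> nlinarith

/-- Split at `j = s_{K+1}`: below it the bound `6Nj` leaves a harmonic sum of size `log s_{K+1}`;
above it the weights sum to at most `1/s_{K+1}`, cancelling the discrepancy factor. -/
theorem sum_Ico_abs_fractCount_le (h : IsConvergentSeq α a q p) {K N : ℕ} (hN : q K ≤ N)
    (hN' : N < q (K + 1)) :
    ∑ j ∈ Ico 1 (q K), |q K * (fractCount α 0 N (j / q K) : ℝ) - N * j| * (1 / ((j : ℝ) * (j + 1)))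
      ≤ 14 * (errLog (quotSum a (K + 1)) * N) := by
  have hq : (0 : ℝ) < q K := by exact_mod_cast h.den_pos K
  have hNq : (q K : ℝ) ≤ N := by exact_mod_cast hN
  set s := quotSum a (K + 1) with hs
  have hs1 : 1 ≤ s := h.one_le_quotSum K
  have hs0 : (0 : ℝ) < s := by exact_mod_cast hs1
  have h1 : ∀ j ∈ Ico 1 (q K),
      |q K * (fractCount α 0 N (j / q K) : ℝ) - N * j| * (1 / ((j : ℝ) * (j + 1))) ≤
      (if j < s then 6 * N * (1 / ((j : ℝ) + 1)) else 0) +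
        (if s ≤ j then 2 * s * q K * (1 / ((j : ℝ) * (j + 1))) else 0) := by
    intro j hj
    rw [mem_Ico] at hj
    obtain ⟨h2, h3⟩ := h.abs_fractCount_mul_sub_le hN hN' hj.1 hj.2.le
    have hj0 : (0 : ℝ) < j := by exact_mod_cast hj.1
    rcases lt_or_ge j s with h4 | h4
    · rw [if_pos h4, if_neg (by omega), add_zero]
      calc _ ≤ 6 * N * j * (1 / ((j : ℝ) * (j + 1))) := by gcongr
        _ = _ := by field_simp
    · rw [if_neg (by omega), if_pos h4, zero_add]
      gcongr
  refine (sum_le_sum h1).trans ?_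
  rw [sum_add_distrib, ← sum_filter, ← sum_filter, ← mul_sum, ← mul_sum]
  have h2 : ∑ j ∈ Ico 1 (q K) with j < s, 1 / ((j : ℝ) + 1) ≤ 1 + Real.log s := by
    refine le_trans ?_ (sum_range_inv_le_one_add_log s)
    apply sum_le_sum_of_subset_of_nonneg
    · intro j hj
      simp only [mem_filter, mem_range] at hj ⊢
      exact hj.2
    · intros; positivity
  have h3 : ∑ j ∈ Ico 1 (q K) with s ≤ j, 1 / ((j : ℝ) * (j + 1)) ≤ 1 / s := by
    refine le_trans ?_ (sum_Ico_inv_mul_succ_le (n := q K) hs1)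
    apply sum_le_sum_of_subset_of_nonneg
    · intro j hj
      simp only [mem_filter, mem_Ico] at hj ⊢
      exact ⟨hj.2, hj.1.2⟩
    · intros; positivity
  have h4 : 2 * s * q K * ∑ j ∈ Ico 1 (q K) with s ≤ j, 1 / ((j : ℝ) * (j + 1)) ≤ 2 * N := by
    calc _ ≤ 2 * s * q K * (1 / (s : ℝ)) := by gcongr
      _ = 2 * q K := by field_simp
      _ ≤ _ := by gcongr
  have h5 : 6 * N * ∑ j ∈ Ico 1 (q K) with j < s, 1 / ((j : ℝ) + 1) ≤
      6 * N * (1 + Real.log s) := by gcongr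
  have h6 := one_le_errLog s
  have h7 := log_le_errLog hs0
  have h8 : (0 : ℝ) ≤ N := by positivity
  nlinarith

theorem floor_den_mul_fract_lt (h : IsConvergentSeq α a q p) (K : ℕ) (x : ℝ) :
    ⌊q K * Int.fract x⌋₊ < q K := by
  have hq : (0 : ℝ) < q K := by exact_mod_cast h.den_pos K
  rw [Nat.floor_lt (mul_nonneg hq.le (Int.fract_nonneg _))]
  nlinarith [Int.fract_lt_one x]

/-- After Abel summation the expected counts `Nj/q_K` reassemble to `N` times the harmonic sum of
length `q_K`. Replacing `log q_K` by `log N` costs another `log s_{K+1}`. -/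
theorem abs_sum_inv_floor_sub_le (h : IsConvergentSeq α a q p) {K N : ℕ} (hN : q K ≤ N)
    (hN' : N < q (K + 1)) :
    |q K * ∑ n ∈ Icc 1 N, 1 / ((⌊q K * Int.fract ((n : ℕ) * α)⌋₊ : ℝ) + 1) - N * Real.log N|
      ≤ 17 * (errLog (quotSum a (K + 1)) * N) := by
  have hq : (0 : ℝ) < q K := by exact_mod_cast h.den_pos K
  have hNq : (q K : ℝ) ≤ N := by exact_mod_cast hN
  have hN0 : (0 : ℝ) < N := hq.trans_le hNq
  have e1 : ∀ j : ℕ, #{n ∈ Icc 1 N | ⌊q K * Int.fract ((n : ℕ) * α)⌋₊ < j} =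
      fractCount α 0 N (j / q K) := by
    intro j
    unfold fractCount
    rw [zero_add]
    have h0 : Ioc 0 N = Icc 1 N := by ext; simp; omega
    rw [h0]
    congr 1
    apply filter_congr
    intro n _
    have := Int.fract_nonneg ((n : ℝ) * α)
    rw [lt_div_iff₀ hq, mul_comm, Nat.floor_lt (by positivity), mul_comm]
  rw [sum_inv_succ_eq_sum_card (Icc 1 N) _ fun n _ => h.floor_den_mul_fract_lt K _]
  simp only [e1]
  rw [Nat.card_Icc, Nat.add_sub_cancel]
  have e2 : q K * ((N : ℝ) / q K + ∑ j ∈ Ico 1 (q K),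
      (fractCount α 0 N (j / q K) : ℝ) * (1 / ((j : ℝ) * (j + 1)))) =
      (∑ j ∈ Ico 1 (q K), (q K * (fractCount α 0 N (j / q K) : ℝ) - N * j) *
        (1 / ((j : ℝ) * (j + 1)))) + N * ∑ j ∈ range (q K), 1 / ((j : ℝ) + 1) := by
    rw [range_eq_Ico, sum_eq_sum_Ico_succ_bot (h.den_pos K), mul_add, mul_add, mul_sum, mul_sum]
    have : ∀ j ∈ Ico 1 (q K), q K * ((fractCount α 0 N (j / q K) : ℝ) * (1 / ((j : ℝ) * (j + 1)))) =
        (q K * (fractCount α 0 N (j / q K) : ℝ) - N * j) * (1 / ((j : ℝ) * (j + 1))) +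
          N * (1 / ((j : ℝ) + 1)) := by
      intro j hj
      have hj0 : (0 : ℝ) < j := by exact_mod_cast (mem_Ico.1 hj).1
      field_simp
      ring
    rw [sum_congr rfl this, sum_add_distrib]
    simp only [zero_add]
    push_cast
    field_simp
    ring
  rw [e2]
  have h1 : |∑ j ∈ Ico 1 (q K), (q K * (fractCount α 0 N (j / q K) : ℝ) - N * j) *
        (1 / ((j : ℝ) * (j + 1)))| ≤ 14 * (errLog (quotSum a (K + 1)) * N) := by
    refine (abs_sum_le_sum_abs _ _).trans (le_trans (le_of_eq ?_)
      (h.sum_Ico_abs_fractCount_le hN hN'))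
    refine sum_congr rfl fun j _ => ?_
    rw [abs_mul, abs_of_nonneg (a := 1 / ((j : ℝ) * (j + 1))) (by positivity)]
  have h2 := sum_range_inv_le_one_add_log (q K)
  have h3 := log_le_sum_range_inv (q K)
  have h4 : Real.log (q K) ≤ Real.log (q K + 1) := Real.log_le_log hq (by linarith)
  have h5 := h.log_div_den_le (Nat.pos_of_ne_zero (by rintro rfl; simp at hN0)) hN'.le
  have h6 : Real.log (q K) ≤ Real.log N := Real.log_le_log hq hNq
  have h7 := one_le_errLog (quotSum a (K + 1))
  rw [abs_le] at h1 ⊢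
  constructor <;> nlinarith

/-- This is the cost of rounding `q_K{nα}` to an integer: each value `j` is taken by at most
`6N/q_K` of the `n`, and `∑ 1/(j(j+1)) ≤ 1`. -/
theorem sum_card_floor_le (h : IsConvergentSeq α a q p) {K N : ℕ} (hN : q K ≤ N) :
    ∑ n ∈ Icc 1 N with 1 ≤ q K * Int.fract ((n : ℕ) * α),
      1 / ((⌊q K * Int.fract ((n : ℕ) * α)⌋₊ : ℝ) * (⌊q K * Int.fract ((n : ℕ) * α)⌋₊ + 1))
      ≤ 6 * (N / q K) := by
  have hq : (0 : ℝ) < q K := by exact_mod_cast h.den_pos K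
  have hmaps : ∀ n ∈ ({n ∈ Icc 1 N | 1 ≤ q K * Int.fract ((n : ℕ) * α)} : Finset ℕ),
      ⌊q K * Int.fract ((n : ℕ) * α)⌋₊ ∈ Ico 1 (q K) := by
    intro n hn
    rw [mem_filter] at hn
    exact mem_Ico.2 ⟨Nat.le_floor (by simpa using hn.2), h.floor_den_mul_fract_lt K _⟩
  rw [← sum_fiberwise_of_maps_to hmaps]
  have h1 : ∀ j ∈ Ico 1 (q K), ∑ n ∈ ({n ∈ Icc 1 N | 1 ≤ q K * Int.fract ((n : ℕ) * α)} :
      Finset ℕ) with ⌊q K * Int.fract ((n : ℕ) * α)⌋₊ = j,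
      1 / ((⌊q K * Int.fract ((n : ℕ) * α)⌋₊ : ℝ) * (⌊q K * Int.fract ((n : ℕ) * α)⌋₊ + 1)) ≤
      6 * (N / q K) * (1 / ((j : ℝ) * (j + 1))) := by
    intro j _
    rw [sum_congr rfl (g := fun _ => 1 / ((j : ℝ) * (j + 1))) (fun n hn => by
      rw [(mem_filter.1 hn).2]), sum_const, nsmul_eq_mul]
    refine mul_le_mul_of_nonneg_right ?_ (by positivity)
    have h2 := h.card_filter_mul_fract_le hN (u := j) (v := j + 1) (by linarith)
    refine (le_trans ?_ h2).trans (le_of_eq (by ring))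
    refine Nat.cast_le.2 (card_le_card fun n hn => ?_)
    rw [mem_filter, mem_filter] at hn
    obtain ⟨⟨hn1, hn2⟩, hn3⟩ := hn
    rw [Nat.floor_eq_iff (by linarith)] at hn3
    exact mem_filter.2 ⟨hn1, hn3⟩
  refine (sum_le_sum h1).trans ?_
  rw [← mul_sum]
  have h2 := sum_Ico_inv_mul_succ_le (m := 1) (n := q K) one_pos
  have h3 : (0 : ℝ) ≤ 6 * (N / q K) := by positivity
  calc _ ≤ 6 * (N / q K) * (1 / ((1 : ℕ) : ℝ)) := by gcongr
    _ = _ := by simp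

theorem abs_inv_sub_inv_floor_succ_le {t : ℝ} (ht : 1 ≤ t) :
    |1 / t - 1 / ((⌊t⌋₊ : ℝ) + 1)| ≤ 1 / ((⌊t⌋₊ : ℝ) * (⌊t⌋₊ + 1)) := by
  have h1 : (1 : ℝ) ≤ ⌊t⌋₊ := by exact_mod_cast (Nat.le_floor (by simpa using ht) : 1 ≤ ⌊t⌋₊)
  have h2 := Nat.floor_le (zero_le_one.trans ht)
  have h3 := Nat.lt_floor_add_one t
  have h4 : 1 / ((⌊t⌋₊ : ℝ) + 1) ≤ 1 / t := one_div_le_one_div_of_le (by linarith) h3.le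
  have h5 : 1 / t ≤ 1 / (⌊t⌋₊ : ℝ) := one_div_le_one_div_of_le (by linarith) h2
  have h6 : 1 / ((⌊t⌋₊ : ℝ) * (⌊t⌋₊ + 1)) = 1 / (⌊t⌋₊ : ℝ) - 1 / ((⌊t⌋₊ : ℝ) + 1) := by
    field_simp
    ring
  rw [abs_of_nonneg (by linarith), h6]
  linarith

/-- The sum of `1 / {n α}` over the `n ≤ N` with `{n α} ≥ 1 / q_K`. -/
theorem abs_sum_one_le_mul_fract_sub_le (h : IsConvergentSeq α a q p) {K N : ℕ} (hN : q K ≤ N)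
    (hN' : N < q (K + 1)) :
    |∑ n ∈ Icc 1 N with 1 ≤ q K * Int.fract ((n : ℕ) * α), 1 / Int.fract ((n : ℕ) * α)
        - N * Real.log N| ≤ 29 * (errLog (quotSum a (K + 1)) * N) := by
  have hq : (0 : ℝ) < q K := by exact_mod_cast h.den_pos K
  have h1 := h.abs_sum_inv_floor_sub_le hN hN'
  have h2 := h.sum_card_floor_le hN
  rw [← sum_filter_add_sum_filter_not (Icc 1 N) (fun n : ℕ => 1 ≤ q K * Int.fract ((n : ℕ) * α)),
    mul_add] at h1
  set S := ({n ∈ Icc 1 N | 1 ≤ q K * Int.fract ((n : ℕ) * α)} : Finset ℕ) with hS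
  set S' := ({n ∈ Icc 1 N | ¬ 1 ≤ q K * Int.fract ((n : ℕ) * α)} : Finset ℕ) with hS'
  have h3 : |∑ n ∈ S, 1 / Int.fract ((n : ℕ) * α) -
      q K * ∑ n ∈ S, 1 / ((⌊q K * Int.fract ((n : ℕ) * α)⌋₊ : ℝ) + 1)| ≤ 6 * N := by
    rw [mul_sum, ← sum_sub_distrib]
    refine (abs_sum_le_sum_abs _ _).trans ?_
    calc _ ≤ ∑ n ∈ S, q K * (1 / ((⌊q K * Int.fract ((n : ℕ) * α)⌋₊ : ℝ) *
          (⌊q K * Int.fract ((n : ℕ) * α)⌋₊ + 1))) := by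
          refine sum_le_sum fun n hn => ?_
          have ht := (mem_filter.1 hn).2
          have h4 := abs_inv_sub_inv_floor_succ_le ht
          have h5 : (1 : ℝ) / Int.fract ((n : ℕ) * α) = q K * (1 / (q K * Int.fract ((n : ℕ) * α))) := by
            field_simp
          rw [h5, ← mul_sub, abs_mul, abs_of_pos hq]
          gcongr
      _ ≤ q K * (6 * (N / q K)) := by rw [← mul_sum]; gcongr
      _ = _ := by field_simp
  -- The rounded sum also runs over the points with floor `0`; there are at most `6N/q_K` of them,
  -- each weighted by at most `1`.
  have h4 : q K * ∑ n ∈ S', 1 / ((⌊q K * Int.fract ((n : ℕ) * α)⌋₊ : ℝ) + 1) ≤ 6 * N := by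
    have h5 := h.card_filter_mul_fract_le hN (u := 0) (v := 1) (by norm_num)
    have h6 : (#S' : ℝ) ≤ 6 * (N / q K) := by
      refine (le_trans (Nat.cast_le.2 (card_le_card fun n hn => ?_)) h5).trans
        (le_of_eq (by ring))
      rw [hS', mem_filter, not_le] at hn
      exact mem_filter.2 ⟨hn.1, mul_nonneg hq.le (Int.fract_nonneg _), hn.2⟩
    calc _ ≤ q K * ∑ n ∈ S', (1 : ℝ) := by
          gcongr
          rw [div_le_one (by positivity)]
          exact le_add_of_nonneg_left (Nat.cast_nonneg _)
      _ ≤ q K * (6 * (N / q K)) := by rw [sum_const, nsmul_eq_mul, mul_one]; gcongr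
      _ = _ := by field_simp
  have h5 : 0 ≤ q K * ∑ n ∈ S', 1 / ((⌊q K * Int.fract ((n : ℕ) * α)⌋₊ : ℝ) + 1) := by positivity
  have h6 := one_le_errLog (quotSum a (K + 1))
  have h7 : (0 : ℝ) ≤ N := by positivity
  rw [abs_le] at *
  constructor <;> nlinarith

end IsConvergentSeq

/-! ### The exceptional points with `{nα} < 1/q_K` -/

theorem sum_Icc_filter_dvd {M : Type*} [AddCommMonoid M] (F : ℕ → M) {q : ℕ} (hq : 0 < q) (N : ℕ) :
    ∑ n ∈ Icc 1 N with q ∣ n, F n = ∑ j ∈ Icc 1 (N / q), F (q * j) := by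
  symm
  refine sum_nbij (fun j => q * j) ?_ ?_ ?_ fun _ _ => rfl
  · intro j hj
    rw [mem_Icc] at hj
    rw [mem_filter, mem_Icc]
    refine ⟨⟨Nat.mul_pos hq hj.1, ?_⟩, dvd_mul_right _ _⟩
    calc q * j ≤ q * (N / q) := Nat.mul_le_mul_left _ hj.2
      _ ≤ N := Nat.mul_div_le N q
  · intro i _ j _ hij
    exact Nat.eq_of_mul_eq_mul_left hq hij
  · intro n hn
    simp only [mem_coe, mem_filter, mem_Icc] at hn
    obtain ⟨⟨h1, h2⟩, j, rfl⟩ := hn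
    refine ⟨j, ?_, rfl⟩
    rw [mem_coe, mem_Icc]
    exact ⟨Nat.pos_of_mul_pos_left h1, (Nat.le_div_iff_mul_le hq).2 (by linarith)⟩

theorem sum_Icc_inv_sqrt_le (n : ℕ) : ∑ j ∈ Icc 1 n, 1 / √(j : ℝ) ≤ 2 * √n := by
  induction n with
  | zero => simp
  | succ n ih =>
    rw [sum_Icc_succ_top (by omega)]
    have h1 : (0 : ℝ) < √(n + 1 : ℕ) := Real.sqrt_pos.2 (by positivity)
    have h2 := Real.sq_sqrt (Nat.cast_nonneg (α := ℝ) n)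
    have h3 := Real.sq_sqrt (Nat.cast_nonneg (α := ℝ) (n + 1))
    have h4 : 1 / √(n + 1 : ℕ) ≤ 2 * √(n + 1 : ℕ) - 2 * √n := by
      rw [div_le_iff₀ h1]
      push_cast at *
      nlinarith [sq_nonneg (√(n + 1 : ℝ) - √n)]
    linarith

namespace IsConvergentSeq

variable {α : ℝ} {a q : ℕ → ℕ} {p : ℕ → ℤ}

theorem fract_mul_den_of_even (h : IsConvergentSeq α a q p) {K : ℕ} (hK : Even K) {j : ℕ}
    (hj : q K * j < q (K + 1)) :
    Int.fract (((q K * j : ℕ) : ℝ) * α) = j * (q K * α - p K) ∧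
      q K * (j * (q K * α - p K)) < 1 := by
  have h1 := h.dist_le K
  have h2 := h.dist_pos K
  rw [hK.neg_one_pow, one_mul] at h1 h2
  have hq : (1 : ℝ) ≤ q K := by exact_mod_cast h.den_pos K
  have hq' : (0 : ℝ) < q (K + 1) := by exact_mod_cast h.den_pos (K + 1)
  have hj' : (q K : ℝ) * j < q (K + 1) := by exact_mod_cast hj
  have h3 : q K * (j * (q K * α - p K)) < 1 := by
    calc q K * (j * (q K * α - p K)) = (q K * j) * (q K * α - p K) := by ring
      _ ≤ (q K * j) * (1 / q (K + 1)) := by gcongr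
      _ = q K * j / q (K + 1) := by ring
      _ < 1 := by rwa [div_lt_one hq']
  have h4 : 0 ≤ j * (q K * α - p K) := by positivity
  refine ⟨?_, h3⟩
  rw [Int.fract_eq_iff]
  refine ⟨h4, by nlinarith, j * p K, ?_⟩
  push_cast
  ring

/-- The integer `n p_K - q_K⌊nα⌋` equals `q_K{nα} - ne`, a difference of two numbers in `[0, 1)`, so
it vanishes and `q_K` divides `n p_K`. -/
theorem mul_fract_lt_one_iff_of_even (h : IsConvergentSeq α a q p) {K : ℕ} (hK : Even K) {n : ℕ}
    (hn : n < q (K + 1)) : q K * Int.fract ((n : ℕ) * α) < 1 ↔ q K ∣ n := by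
  constructor
  · intro hf
    have h1 := h.dist_le K
    have h2 := h.dist_pos K
    rw [hK.neg_one_pow, one_mul] at h1 h2
    have hq' : (0 : ℝ) < q (K + 1) := by exact_mod_cast h.den_pos (K + 1)
    have hn' : (n : ℝ) < q (K + 1) := by exact_mod_cast hn
    have h3 : n * (q K * α - p K) < 1 := by
      calc n * (q K * α - p K) ≤ n * (1 / q (K + 1)) := by gcongr
        _ = n / q (K + 1) := by ring
        _ < 1 := by rwa [div_lt_one hq']
    have h4 : 0 ≤ n * (q K * α - p K) := by positivity
    have h5 := Int.fract_nonneg ((n : ℝ) * α)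
    have hz : ((n * p K - q K * ⌊(n : ℝ) * α⌋ : ℤ) : ℝ) =
        q K * Int.fract ((n : ℝ) * α) - n * (q K * α - p K) := by
      simp only [Int.fract]
      push_cast
      ring
    have h6 : (n * p K - q K * ⌊(n : ℝ) * α⌋ : ℤ) < 1 := by
      have : ((n * p K - q K * ⌊(n : ℝ) * α⌋ : ℤ) : ℝ) < 1 := by rw [hz]; linarith
      exact_mod_cast this
    have h7 : -1 < (n * p K - q K * ⌊(n : ℝ) * α⌋ : ℤ) := by
      have : (-1 : ℝ) < ((n * p K - q K * ⌊(n : ℝ) * α⌋ : ℤ) : ℝ) := by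
        rw [hz]
        have : 0 ≤ q K * Int.fract ((n : ℝ) * α) := by positivity
        linarith
      exact_mod_cast this
    have h8 : (q K : ℤ) ∣ n * p K := ⟨⌊(n : ℝ) * α⌋, by omega⟩
    exact_mod_cast (h.isCoprime K).symm.dvd_of_dvd_mul_right h8
  · rintro ⟨j, rfl⟩
    obtain ⟨h1, h2⟩ := h.fract_mul_den_of_even hK hn
    rwa [h1]

/-- Now `n p_K - q_K⌊nα⌋ = q_K{nα} + ne` lies strictly between `0` and `2`, so it is `1`. The
determinant identity gives `q_{K+1} p_K ≡ 1` modulo `q_K` as well, whence `n ≡ q_{K+1}`. -/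
theorem mul_fract_of_odd (h : IsConvergentSeq α a q p) {K : ℕ} (hK : Odd K) {n : ℕ}
    (hn0 : 0 < n) (hn : n < q (K + 1)) (hf : q K * Int.fract ((n : ℕ) * α) < 1) :
    q K * Int.fract ((n : ℕ) * α) = 1 - n * (p K - q K * α) ∧ q K ∣ q (K + 1) - n := by
  have h1 := h.dist_le K
  have h2 := h.dist_pos K
  rw [hK.neg_one_pow] at h1 h2
  have hq' : (0 : ℝ) < q (K + 1) := by exact_mod_cast h.den_pos (K + 1)
  have hn' : (n : ℝ) < q (K + 1) := by exact_mod_cast hn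
  have hn0' : (0 : ℝ) < n := by exact_mod_cast hn0
  have h2' : 0 < p K - q K * α := by linarith
  have h3 : n * (p K - q K * α) < 1 := by
    calc n * (p K - q K * α) ≤ n * (1 / q (K + 1)) := by gcongr; linarith
      _ = n / q (K + 1) := by ring
      _ < 1 := by rwa [div_lt_one hq']
  have h4 : 0 < n * (p K - q K * α) := by positivity
  have h5 := Int.fract_nonneg ((n : ℝ) * α)
  have h5' : 0 ≤ q K * Int.fract ((n : ℝ) * α) := by positivity
  have hz : ((n * p K - q K * ⌊(n : ℝ) * α⌋ : ℤ) : ℝ) =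
      q K * Int.fract ((n : ℝ) * α) + n * (p K - q K * α) := by
    simp only [Int.fract]
    push_cast
    ring
  have h6 : (n * p K - q K * ⌊(n : ℝ) * α⌋ : ℤ) < 2 := by
    have : ((n * p K - q K * ⌊(n : ℝ) * α⌋ : ℤ) : ℝ) < 2 := by rw [hz]; linarith
    exact_mod_cast this
  have h7 : 0 < (n * p K - q K * ⌊(n : ℝ) * α⌋ : ℤ) := by
    have : (0 : ℝ) < ((n * p K - q K * ⌊(n : ℝ) * α⌋ : ℤ) : ℝ) := by rw [hz]; linarith
    exact_mod_cast this
  have h8 : (n * p K - q K * ⌊(n : ℝ) * α⌋ : ℤ) = 1 := by omega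
  constructor
  · rw [h8] at hz
    push_cast at hz
    linarith
  · have hd := h.det K
    rw [hK.add_one.neg_one_pow] at hd
    have h9 : (q K : ℤ) ∣ ((q (K + 1) : ℤ) - n) * p K :=
      ⟨p (K + 1) - ⌊(n : ℝ) * α⌋, by linear_combination hd - h8⟩
    have h10 := (h.isCoprime K).symm.dvd_of_dvd_mul_right h9
    zify [hn.le]
    exact h10

/-- If `N ≤ q_{K+1}/2`, then `q_K{nα} = 1 - ne ≥ 1/2`, and there are `O(N/q_K)` terms of size
`O(q_K)`. Otherwise `1/e = O(N)`, and counting down from `q_{K+1}` in steps of `q_K` gives a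
harmonic sum. -/
theorem sum_mul_fract_lt_one_le_of_odd (h : IsConvergentSeq α a q p) {K N : ℕ} (hK : Odd K)
    (hN : q K ≤ N) (hN' : N < q (K + 1)) :
    ∑ n ∈ Icc 1 N with q K * Int.fract ((n : ℕ) * α) < 1, 1 / Int.fract ((n : ℕ) * α)
      ≤ 12 * (errLog (quotSum a (K + 1)) * N) := by
  have h1 := h.dist_le K
  have h2 := h.dist_pos K
  have h2' := h.le_dist K
  rw [hK.neg_one_pow] at h1 h2 h2'
  set e : ℝ := p K - q K * α with he
  have h1 : e ≤ 1 / q (K + 1) := by linarith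
  have h2 : 0 < e := by linarith
  have h2' : 1 / ((q (K + 1) : ℝ) + q K) ≤ e := by linarith
  have hq : (0 : ℝ) < q K := by exact_mod_cast h.den_pos K
  have hq' : (0 : ℝ) < q (K + 1) := by exact_mod_cast h.den_pos (K + 1)
  have hqN : (q K : ℝ) ≤ N := by exact_mod_cast hN
  have hL := one_le_errLog (quotSum a (K + 1))
  set S := ({n ∈ Icc 1 N | q K * Int.fract ((n : ℕ) * α) < 1} : Finset ℕ) with hS
  have key : ∀ n ∈ S, 0 < n ∧ n ≤ N ∧ q K * Int.fract ((n : ℕ) * α) = 1 - n * e ∧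
      q K ∣ q (K + 1) - n := by
    intro n hn
    rw [hS, mem_filter, mem_Icc] at hn
    exact ⟨hn.1.1, hn.1.2, h.mul_fract_of_odd hK hn.1.1 (by omega) hn.2⟩
  rcases le_or_gt (2 * N) (q (K + 1)) with hc | hc
  · have h3 : (#S : ℝ) ≤ 6 * (N / q K) := by
      have h5 := h.card_filter_mul_fract_le hN (u := 0) (v := 1) (by norm_num)
      refine (le_trans (Nat.cast_le.2 (card_le_card fun n hn => ?_)) h5).trans
        (le_of_eq (by ring))
      rw [hS, mem_filter] at hn
      exact mem_filter.2 ⟨hn.1, mul_nonneg hq.le (Int.fract_nonneg _), hn.2⟩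
    have h4 : ∀ n ∈ S, 1 / Int.fract ((n : ℕ) * α) ≤ 2 * q K := by
      intro n hn
      obtain ⟨_, h5, h6, _⟩ := key n hn
      have h5' : (n : ℝ) ≤ N := by exact_mod_cast h5
      have hc' : 2 * (N : ℝ) ≤ q (K + 1) := by exact_mod_cast hc
      have h7 : n * e ≤ 1 / 2 := by
        calc n * e ≤ (q (K + 1) / 2) * (1 / q (K + 1)) := by gcongr; linarith
          _ = 1 / 2 := by field_simp
      have h8 : 0 < Int.fract ((n : ℕ) * α) := by
        by_contra h9
        have := Int.fract_nonneg ((n : ℝ) * α)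
        nlinarith
      rw [div_le_iff₀ h8]
      nlinarith
    calc _ ≤ ∑ n ∈ S, (2 * q K : ℝ) := sum_le_sum h4
      _ ≤ 6 * (N / q K) * (2 * q K) := by rw [sum_const, nsmul_eq_mul]; gcongr
      _ = 12 * (1 * N) := by field_simp; ring
      _ ≤ _ := by gcongr
  · have hjs : ∀ n ∈ S, ∃ j, n + q K * (j + 1) = q (K + 1) := by
      intro n hn
      obtain ⟨_, h5, h6, j, hj⟩ := key n hn
      cases j with
      | zero => omega
      | succ j => exact ⟨j, by omega⟩
    choose! J hJ using hjs
    have hJinj : Set.InjOn J S := by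
      intro n hn m hm hnm
      have h3 := hJ n hn
      have h4 := hJ m hm
      rw [hnm] at h3
      omega
    have h4 : ∀ n ∈ S, 1 / Int.fract ((n : ℕ) * α) ≤ 1 / e * (1 / ((J n : ℝ) + 1)) := by
      intro n hn
      obtain ⟨_, _, h6, _⟩ := key n hn
      have h7 : (n : ℝ) + q K * (J n + 1) = q (K + 1) := by exact_mod_cast hJ n hn
      have h8 : q (K + 1) * e ≤ 1 := by
        calc q (K + 1) * e ≤ q (K + 1) * (1 / q (K + 1)) := by gcongr
          _ = 1 := by field_simp
      -- Since `q_{K+1} e ≤ 1`, one has `1 - ne ≥ (q_{K+1} - n)e = q_K (J n + 1) e`.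
      have h9 : (J n + 1) * e ≤ Int.fract ((n : ℕ) * α) := by
        refine le_of_mul_le_mul_left (a := (q K : ℝ)) ?_ hq
        rw [h6]
        nlinarith
      rw [one_div_mul_one_div, mul_comm e]
      exact one_div_le_one_div_of_le (by positivity) h9
    have h5 : ∑ n ∈ S, 1 / ((J n : ℝ) + 1) ≤ 1 + Real.log ((2 * quotSum a (K + 1) : ℕ) : ℝ) := by
      refine le_trans ?_ (sum_range_inv_le_one_add_log _)
      rw [← sum_image (f := fun j : ℕ => 1 / ((j : ℝ) + 1)) hJinj]
      apply sum_le_sum_of_subset_of_nonneg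
      · intro j hj
        obtain ⟨n, hn, rfl⟩ := mem_image.1 hj
        have h6 := hJ n hn
        have h7 := h.den_succ_le_two_mul_quotSum K
        rw [mem_range]
        have h8 : q K * (J n + 1) ≤ q K * (2 * quotSum a (K + 1)) := by
          rw [mul_comm (q K) (2 * _)]; omega
        have := Nat.le_of_mul_le_mul_left h8 (h.den_pos K)
        omega
      · intros; positivity
    have hs : (0 : ℝ) < quotSum a (K + 1) := by exact_mod_cast h.one_le_quotSum K
    have h6 : 1 + Real.log ((2 * quotSum a (K + 1) : ℕ) : ℝ) ≤ 3 * errLog (quotSum a (K + 1)) := by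
      push_cast
      rw [Real.log_mul (by norm_num) hs.ne']
      have := log_le_errLog hs
      have := Real.log_two_lt_d9
      linarith
    have h7 : 1 / e ≤ 3 * N := by
      have h8 : 1 / e ≤ q (K + 1) + q K := by
        rw [div_le_iff₀ h2]
        rwa [div_le_iff₀ (by positivity), mul_comm] at h2'
      have hc' : (q (K + 1) : ℝ) < 2 * N := by exact_mod_cast hc
      linarith
    calc _ ≤ ∑ n ∈ S, 1 / e * (1 / ((J n : ℝ) + 1)) := sum_le_sum h4
      _ = 1 / e * ∑ n ∈ S, 1 / ((J n : ℝ) + 1) := by rw [mul_sum]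
      _ ≤ (3 * N) * (3 * errLog (quotSum a (K + 1))) := by
          gcongr
          · exact h5.trans h6
      _ ≤ _ := by nlinarith [mul_nonneg (zero_le_one.trans hL) (Nat.cast_nonneg (α := ℝ) N)]

/-- `fractSum` with the terms `{n α} < 1 / q_K` removed. -/
theorem abs_fractSum_sub_le (h : IsConvergentSeq α a q p) {K N : ℕ} (hN : q K ≤ N)
    (hN' : N < q (K + 1)) {c : ℝ} (hc : 0 < c) :
    |fractSum c α N - N * Real.log N -
      ∑ n ∈ Icc 1 N with c / N ≤ Int.fract ((n : ℕ) * α) ∧ q K * Int.fract ((n : ℕ) * α) < 1,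
        1 / Int.fract ((n : ℕ) * α)| ≤ (33 + 2 * c) * (errLog (quotSum a (K + 1)) * N) := by
  have hq : (0 : ℝ) < q K := by exact_mod_cast h.den_pos K
  have hqN : (q K : ℝ) ≤ N := by exact_mod_cast hN
  have hN0 : (0 : ℝ) < N := hq.trans_le hqN
  have hL := one_le_errLog (quotSum a (K + 1))
  have h1 := h.abs_sum_one_le_mul_fract_sub_le hN hN'
  unfold fractSum
  rw [← sum_filter_add_sum_filter_not ({n ∈ Icc 1 N | c / N ≤ Int.fract ((n : ℕ) * α)})
    (fun n : ℕ => 1 ≤ q K * Int.fract ((n : ℕ) * α)), filter_filter, filter_filter]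
  rw [← sum_filter_add_sum_filter_not ({n ∈ Icc 1 N | 1 ≤ q K * Int.fract ((n : ℕ) * α)})
    (fun n : ℕ => c / N ≤ Int.fract ((n : ℕ) * α)), filter_filter, filter_filter] at h1
  simp only [not_le] at h1 ⊢
  have e1 : ({n ∈ Icc 1 N | c / N ≤ Int.fract ((n : ℕ) * α) ∧ 1 ≤ q K * Int.fract ((n : ℕ) * α)} :
      Finset ℕ) =
      {n ∈ Icc 1 N | 1 ≤ q K * Int.fract ((n : ℕ) * α) ∧ c / N ≤ Int.fract ((n : ℕ) * α)} :=
    filter_congr fun _ _ => and_comm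
  rw [e1]
  set S := ({n ∈ Icc 1 N | 1 ≤ q K * Int.fract ((n : ℕ) * α) ∧ Int.fract ((n : ℕ) * α) < c / N} :
      Finset ℕ) with hS
  have h2 : 0 ≤ ∑ n ∈ S, 1 / Int.fract ((n : ℕ) * α) :=
    sum_nonneg fun n _ => div_nonneg zero_le_one (Int.fract_nonneg _)
  -- These are the terms of the main sum removed by the cutoff: each is at most `q_K`, and there are
  -- at most `2(N/q_K)(q_K c/N + 2)` of them.
  have h3 : ∑ n ∈ S, 1 / Int.fract ((n : ℕ) * α) ≤ (4 + 2 * c) * N := by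
    have h4 := h.card_filter_mul_fract_le hN (u := 0) (v := q K * (c / N)) (by positivity)
    have h5 : (#S : ℝ) ≤ 2 * (N / q K) * (q K * (c / N) - 0 + 2) := by
      refine le_trans (Nat.cast_le.2 (card_le_card fun n hn => ?_)) h4
      rw [hS, mem_filter] at hn
      refine mem_filter.2 ⟨hn.1, mul_nonneg hq.le (Int.fract_nonneg _), ?_⟩
      exact mul_lt_mul_of_pos_left hn.2.2 hq
    calc _ ≤ ∑ n ∈ S, (q K : ℝ) := by
          refine sum_le_sum fun n hn => ?_
          have h6 := (mem_filter.1 hn).2.1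
          have h7 : 0 < Int.fract ((n : ℕ) * α) := by
            by_contra h9
            have := Int.fract_nonneg ((n : ℝ) * α)
            nlinarith
          rwa [div_le_iff₀ h7]
      _ ≤ 2 * (N / q K) * (q K * (c / N) - 0 + 2) * q K := by
          rw [sum_const, nsmul_eq_mul]; gcongr
      _ = 2 * c * q K + 4 * N := by field_simp; ring
      _ ≤ _ := by nlinarith
  have h4 : (4 + 2 * c) * N ≤ (4 + 2 * c) * (errLog (quotSum a (K + 1)) * N) := by
    gcongr
    nlinarith
  rw [abs_le] at *
  constructor <;> linarith

theorem sum_mul_fract_lt_one_of_even (h : IsConvergentSeq α a q p) {K N : ℕ} (hK : Even K)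
    (hN' : N < q (K + 1)) (x : ℝ) :
    ∑ n ∈ Icc 1 N with x ≤ Int.fract ((n : ℕ) * α) ∧ q K * Int.fract ((n : ℕ) * α) < 1,
        1 / Int.fract ((n : ℕ) * α) =
      ∑ j ∈ Icc 1 (N / q K) with x ≤ (j : ℕ) * (q K * α - p K),
        1 / ((j : ℕ) * (q K * α - p K)) := by
  have e1 : ({n ∈ Icc 1 N | x ≤ Int.fract ((n : ℕ) * α) ∧ q K * Int.fract ((n : ℕ) * α) < 1} :
      Finset ℕ) = {n ∈ {n ∈ Icc 1 N | q K ∣ n} | x ≤ Int.fract ((n : ℕ) * α)} := by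
    rw [filter_filter]
    refine filter_congr fun n hn => ?_
    rw [h.mul_fract_lt_one_iff_of_even hK ((mem_Icc.1 hn).2.trans_lt hN'), and_comm]
  rw [e1, sum_filter, sum_Icc_filter_dvd _ (h.den_pos K), sum_filter]
  refine sum_congr rfl fun j hj => ?_
  have h1 : q K * j < q (K + 1) :=
    ((Nat.mul_le_mul_left _ (mem_Icc.1 hj).2).trans (Nat.mul_div_le N (q K))).trans_lt hN'
  rw [(h.fract_mul_den_of_even hK h1).1]

/-- Combines the two bounds for the distance with `a_{K+1} q_K ≤ q_{K+1} ≤ (a_{K+1} + 1) q_K`. -/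
theorem inv_dist_div_den_le (h : IsConvergentSeq α a q p) {K : ℕ} (hK : Even K) :
    1 / (q K * (q K * α - p K)) ≤ a (K + 1) + 2 ∧ (a (K + 1) : ℝ) ≤ 1 / (q K * (q K * α - p K)) := by
  have h1 := h.dist_le K
  have h2 := h.dist_pos K
  have h3 := h.le_dist K
  rw [hK.neg_one_pow, one_mul] at h1 h2 h3
  have hq : (0 : ℝ) < q K := by exact_mod_cast h.den_pos K
  have hq' : (0 : ℝ) < q (K + 1) := by exact_mod_cast h.den_pos (K + 1)
  have h4 : (q (K + 1) : ℝ) ≤ (a (K + 1) + 1) * q K := by exact_mod_cast h.den_succ_le K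
  have h5 : (a (K + 1) : ℝ) * q K ≤ q (K + 1) := by exact_mod_cast h.quot_mul_den_le K
  rw [div_le_iff₀ (by positivity)] at h3
  rw [le_div_iff₀ (by positivity)] at h1
  constructor
  · rw [div_le_iff₀ (by positivity)]
    nlinarith
  · rw [le_div_iff₀ (by positivity)]
    nlinarith

/-- For `t = je ≥ c/N` one has `1/t ≤ √(N/c)/√t`. Summing `1/√j` up to `N/q_K` then gives a multiple
of `(N/√c)(q_K e)^{-1/2}`, and `(q_K e)⁻¹ ≤ a_{K+1} + 2`. -/
theorem sum_inv_mul_dist_le (h : IsConvergentSeq α a q p) {K N : ℕ} (hK : Even K)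
    (hN : q K ≤ N) {c : ℝ} (hc : 0 < c) :
    ∑ j ∈ Icc 1 (N / q K) with c / N ≤ (j : ℕ) * (q K * α - p K), 1 / ((j : ℕ) * (q K * α - p K))
      ≤ 4 / √c * (√(a (K + 1)) * N) := by
  have h2 := h.dist_pos K
  rw [hK.neg_one_pow, one_mul] at h2
  have h3 := (h.inv_dist_div_den_le hK).1
  set e := (q K : ℝ) * α - p K with he
  have hq : (0 : ℝ) < q K := by exact_mod_cast h.den_pos K
  have hqN : (q K : ℝ) ≤ N := by exact_mod_cast hN
  have hN0 : (0 : ℝ) < N := hq.trans_le hqN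
  have ha : (1 : ℝ) ≤ a (K + 1) := by exact_mod_cast h.one_le_quot K
  have h4 : ∀ j ∈ ({j ∈ Icc 1 (N / q K) | c / N ≤ (j : ℕ) * e} : Finset ℕ),
      1 / ((j : ℕ) * e) ≤ √(N / (c * e)) * (1 / √(j : ℝ)) := by
    intro j hj
    rw [mem_filter, mem_Icc, div_le_iff₀ hN0] at hj
    have hj0 : (0 : ℝ) < j := by exact_mod_cast hj.1.1
    rw [← Real.sqrt_one, ← Real.sqrt_div zero_le_one, ← Real.sqrt_mul (by positivity)]
    apply Real.le_sqrt_of_sq_le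
    rw [Real.sqrt_one, div_mul_div_comm, div_pow, div_le_div_iff₀ (by positivity) (by positivity)]
    have : 0 < j * e := by positivity
    nlinarith
  have h5 : √(((N / q K : ℕ) : ℝ)) ≤ √(N / q K) := Real.sqrt_le_sqrt Nat.cast_div_le
  calc _ ≤ ∑ j ∈ Icc 1 (N / q K) with c / N ≤ (j : ℕ) * e, √(N / (c * e)) * (1 / √(j : ℝ)) :=
        sum_le_sum h4
    _ ≤ ∑ j ∈ Icc 1 (N / q K), √(N / (c * e)) * (1 / √(j : ℝ)) :=
        sum_le_sum_of_subset_of_nonneg (filter_subset _ _) fun _ _ _ => by positivity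
    _ ≤ √(N / (c * e)) * (2 * √(N / q K)) := by
        rw [← mul_sum]
        gcongr
        exact (sum_Icc_inv_sqrt_le _).trans (by gcongr)
    _ = √(4 * (N / (c * e) * (N / q K))) := by
        rw [Real.sqrt_mul (by norm_num), Real.sqrt_mul (by positivity),
          show (4 : ℝ) = 2 ^ 2 by norm_num, Real.sqrt_sq (by norm_num)]
        ring
    _ ≤ √(4 ^ 2 / c * (a (K + 1) * N ^ 2)) := by
        apply Real.sqrt_le_sqrt
        have : 4 * (N / (c * e) * (N / q K)) = 4 * (1 / (q K * e)) * (N ^ 2 / c) := by field_simp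
        rw [this]
        calc _ ≤ (4 ^ 2 * a (K + 1)) * (N ^ 2 / c) :=
              mul_le_mul_of_nonneg_right (by linarith) (by positivity)
          _ = _ := by ring
    _ = _ := by
        rw [Real.sqrt_mul (by positivity), Real.sqrt_mul (by positivity), Real.sqrt_div (by positivity),
          Real.sqrt_sq (by norm_num), Real.sqrt_sq hN0.le]

theorem abs_fractSum_sub_log_le (h : IsConvergentSeq α a q p) {K N : ℕ} (hN : q K ≤ N)
    (hN' : N < q (K + 1)) {c : ℝ} (hc : 0 < c) :
    |fractSum c α N - N * Real.log N| ≤ (45 + 2 * c + 4 / √c) *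
      (((if Odd (K + 1) then √(a (K + 1)) else 0) + errLog (quotSum a (K + 1))) * N) := by
  have h1 := h.abs_fractSum_sub_le hN hN' hc
  have hL := one_le_errLog (quotSum a (K + 1))
  have hN0 : (0 : ℝ) ≤ N := by positivity
  set B := ∑ n ∈ Icc 1 N with c / N ≤ Int.fract ((n : ℕ) * α) ∧ q K * Int.fract ((n : ℕ) * α) < 1,
        1 / Int.fract ((n : ℕ) * α) with hB
  set L := errLog (quotSum a (K + 1)) with hLdef
  have hB0 : 0 ≤ B := sum_nonneg fun n _ => div_nonneg zero_le_one (Int.fract_nonneg _)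
  have hs : 0 < √c := Real.sqrt_pos.2 hc
  have key : B ≤ (12 + 4 / √c) * (((if Odd (K + 1) then √(a (K + 1)) else 0) + L) * N) := by
    rcases Nat.even_or_odd K with hK | hK
    · rw [if_pos hK.add_one, hB, h.sum_mul_fract_lt_one_of_even hK hN']
      refine (h.sum_inv_mul_dist_le hK hN hc).trans ?_
      gcongr <;> linarith
    · rw [if_neg (by rw [Nat.not_odd_iff_even]; exact hK.add_one), zero_add]
      calc B ≤ ∑ n ∈ Icc 1 N with q K * Int.fract ((n : ℕ) * α) < 1, 1 / Int.fract ((n : ℕ) * α) := by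
            apply sum_le_sum_of_subset_of_nonneg
            · intro n hn
              rw [mem_filter] at hn ⊢
              exact ⟨hn.1, hn.2.2⟩
            · intro n _ _
              exact div_nonneg zero_le_one (Int.fract_nonneg _)
        _ ≤ 12 * (L * N) := h.sum_mul_fract_lt_one_le_of_odd hK hN hN'
        _ ≤ _ := by
            gcongr
            have : 0 ≤ 4 / √c := by positivity
            linarith
  have h2 : (33 + 2 * c) * (L * N) ≤
      (33 + 2 * c) * (((if Odd (K + 1) then √(a (K + 1)) else 0) + L) * N) := by
    gcongr
    split_ifs
    · have := Real.sqrt_nonneg (a (K + 1))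
      linarith
    · linarith
  have h3 : (45 + 2 * c + 4 / √c) * (((if Odd (K + 1) then √(a (K + 1)) else 0) + L) * N) =
    (33 + 2 * c) * (((if Odd (K + 1) then √(a (K + 1)) else 0) + L) * N) +
      (12 + 4 / √c) * (((if Odd (K + 1) then √(a (K + 1)) else 0) + L) * N) := by ring
  rw [abs_le] at *
  rw [h3]
  have : 0 ≤ (12 + 4 / √c) * (((if Odd (K + 1) then √(a (K + 1)) else 0) + L) * N) := hB0.trans key
  constructor <;> linarith

end IsConvergentSeq

/-! ### The lower bound -/

/-- The two dyadic pieces `[m, 2m)` and `[2m, 4m]` contribute at least `1/2` each. -/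
theorem one_le_sum_Icc_inv {m : ℕ} (hm : 0 < m) : 1 ≤ ∑ j ∈ Icc m (4 * m), 1 / (j : ℝ) := by
  have hm' : (0 : ℝ) < m := by exact_mod_cast hm
  have h1 : ∑ j ∈ Ico m (2 * m), 1 / (j : ℝ) ≥ 1 / 2 := by
    calc ∑ j ∈ Ico m (2 * m), 1 / (j : ℝ) ≥ ∑ j ∈ Ico m (2 * m), 1 / (2 * m : ℝ) := by
          refine sum_le_sum fun j hj => ?_
          rw [mem_Ico] at hj
          have h1 : (0 : ℝ) < j := by exact_mod_cast hm.trans_le hj.1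
          have h2 : (j : ℝ) ≤ 2 * m := by exact_mod_cast hj.2.le
          exact one_div_le_one_div_of_le h1 h2
      _ = 1 / 2 := by
          rw [sum_const, Nat.card_Ico, show 2 * m - m = m by omega, nsmul_eq_mul]
          field_simp
  have h2 : ∑ j ∈ Icc (2 * m) (4 * m), 1 / (j : ℝ) ≥ 1 / 2 := by
    calc ∑ j ∈ Icc (2 * m) (4 * m), 1 / (j : ℝ) ≥ ∑ j ∈ Icc (2 * m) (4 * m), 1 / (4 * m : ℝ) := by
          refine sum_le_sum fun j hj => ?_
          rw [mem_Icc] at hj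
          have h1 : (0 : ℝ) < j := by exact_mod_cast (by omega : 0 < j)
          have h2 : (j : ℝ) ≤ 4 * m := by exact_mod_cast hj.2
          exact one_div_le_one_div_of_le h1 h2
      _ ≥ 1 / 2 := by
          rw [sum_const, Nat.card_Icc, show 4 * m + 1 - 2 * m = 2 * m + 1 by omega, nsmul_eq_mul]
          push_cast
          rw [ge_iff_le, mul_one_div, div_le_div_iff₀ (by norm_num) (by positivity)]
          linarith
  have h3 : Icc m (4 * m) = Ico m (2 * m) ∪ Icc (2 * m) (4 * m) := by
    ext j
    simp only [mem_union, mem_Icc, mem_Ico]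
    omega
  rw [h3, sum_union]
  · linarith
  · refine Finset.disjoint_left.2 fun j h4 h5 => ?_
    simp only [mem_Icc, mem_Ico] at h4 h5
    omega

/-- A harmonic sum over `[x, T]` with `T` eight times as large as `x` is at least `1`. -/
theorem one_le_sum_Icc_inv_filter {x : ℝ} {T : ℕ} (hT : 1 ≤ T) (hx : 8 * x < T + 1) :
    1 ≤ ∑ j ∈ Icc 1 T with x ≤ (j : ℕ), 1 / (j : ℝ) := by
  -- If `x > 1`, then `4⌈x⌉ < 4x + 4 < 8x < T + 1`; if `x ≤ 1`, the single term `j = 1` suffices.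
  have hm : ∃ m : ℕ, 0 < m ∧ x ≤ m ∧ (m = 1 ∨ 4 * m ≤ T) := by
    rcases le_or_gt x 1 with h1 | h1
    · exact ⟨1, one_pos, by simpa using h1, Or.inl rfl⟩
    · have h2 := Nat.le_ceil x
      have h3 := Nat.ceil_lt_add_one (zero_le_one.trans h1.le)
      refine ⟨⌈x⌉₊, Nat.ceil_pos.2 (zero_lt_one.trans h1), h2, Or.inr ?_⟩
      have : (4 : ℝ) * ⌈x⌉₊ < T + 1 := by linarith
      exact Nat.lt_succ_iff.1 (by exact_mod_cast this)
  obtain ⟨m, hm0, hxm, rfl | hmT⟩ := hm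
  · calc (1 : ℝ) = ∑ j ∈ ({1} : Finset ℕ), 1 / (j : ℝ) := by simp
      _ ≤ _ := by
        apply sum_le_sum_of_subset_of_nonneg
        · intro j hj
          rw [mem_singleton] at hj
          subst hj
          exact mem_filter.2 ⟨mem_Icc.2 ⟨le_rfl, hT⟩, hxm⟩
        · intros; positivity
  · refine (one_le_sum_Icc_inv hm0).trans ?_
    apply sum_le_sum_of_subset_of_nonneg
    · intro j hj
      rw [mem_Icc] at hj
      refine mem_filter.2 ⟨mem_Icc.2 ⟨by omega, by omega⟩, hxm.trans ?_⟩
      exact_mod_cast hj.1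
    · intros; positivity

namespace IsConvergentSeq

variable {α : ℝ} {a q : ℕ → ℕ} {p : ℕ → ℤ}

theorem le_fractSum (h : IsConvergentSeq α a q p) {K N : ℕ} (hN : q K ≤ N)
    (hN' : N < q (K + 1)) {c : ℝ} (hc : 0 < c) (hcN : 4 * √(c * a (K + 1)) * q K ≤ N)
    (hK : Odd (K + 1)) :
    N * Real.log N + q (K + 1) - (35 + 2 * c) * (errLog (quotSum a (K + 1)) * N) ≤
      fractSum c α N := by
  have hK : Even K := by rwa [Nat.odd_add_one, Nat.not_odd_iff_even] at hK
  have h1 := h.abs_fractSum_sub_le hN hN' hc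
  rw [h.sum_mul_fract_lt_one_of_even hK hN'] at h1
  have hL := one_le_errLog (quotSum a (K + 1))
  have hd := h.dist_le K
  have hd0 := h.dist_pos K
  rw [hK.neg_one_pow, one_mul] at hd hd0
  have hd1 := (h.inv_dist_div_den_le hK).1
  set e := (q K : ℝ) * α - p K with he
  set L := errLog (quotSum a (K + 1)) with hLdef
  have hq : (0 : ℝ) < q K := by exact_mod_cast h.den_pos K
  have hq' : (0 : ℝ) < q (K + 1) := by exact_mod_cast h.den_pos (K + 1)
  have hqN : (q K : ℝ) ≤ N := by exact_mod_cast hN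
  have hN0 : (0 : ℝ) < N := hq.trans_le hqN
  have ha : 1 ≤ a (K + 1) := h.one_le_quot K
  have hq2 : (q (K + 1) : ℝ) ≤ (a (K + 1) + 1) * q K := by exact_mod_cast h.den_succ_le K
  have key : (q (K + 1) : ℝ) - 2 * (L * N) ≤
      ∑ j ∈ Icc 1 (N / q K) with c / N ≤ (j : ℕ) * e, 1 / ((j : ℕ) * e) := by
    -- If `a_{K+1} = 1`, then `q_{K+1} ≤ 2 q_K ≤ 2N` is absorbed by the error. Otherwise `a_{K+1} +
    -- 2 ≤ 2a_{K+1}`, which is needed for `hx`.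
    rcases (Nat.lt_or_ge (a (K + 1)) 2) with h2 | h2
    · have h3 : a (K + 1) = 1 := by omega
      rw [h3] at hq2
      have h4 : 0 ≤ ∑ j ∈ Icc 1 (N / q K) with c / N ≤ (j : ℕ) * e, 1 / ((j : ℕ) * e) :=
        sum_nonneg fun _ _ => by positivity
      push_cast at hq2
      nlinarith
    · have h2' : (2 : ℝ) ≤ a (K + 1) := by exact_mod_cast h2
      have hT : 1 ≤ N / q K := (Nat.le_div_iff_mul_le (h.den_pos K)).2 (by omega)
      have hsq : 16 * (c * a (K + 1)) * q K ^ 2 ≤ N ^ 2 := by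
        have h3 := Real.sq_sqrt (show 0 ≤ c * a (K + 1) by positivity)
        have h4 : (4 * √(c * a (K + 1)) * q K) ^ 2 ≤ (N : ℝ) ^ 2 := by gcongr
        nlinarith
      -- The factor `4` in the hypothesis becomes `16` on squaring; with `(q_K e)⁻¹ ≤ 2a_{K+1}` this
      -- leaves exactly the ratio `8` required of the harmonic range.
      have hx : 8 * (c / (N * e)) ≤ N / q K := by
        rw [mul_div_assoc', div_le_div_iff₀ (by positivity) hq]
        have h5 : 1 ≤ (2 * a (K + 1)) * (q K * e) := by
          rw [div_le_iff₀ (by positivity)] at hd1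
          nlinarith [mul_pos hq hd0]
        calc 8 * c * q K ≤ 8 * c * q K * ((2 * a (K + 1)) * (q K * e)) :=
              le_mul_of_one_le_right (by positivity) h5
          _ = (16 * (c * a (K + 1)) * q K ^ 2) * e := by ring
          _ ≤ N ^ 2 * e := by gcongr
          _ = N * (N * e) := by ring
      have hx' : 8 * (c / (N * e)) < (N / q K : ℕ) + 1 := by
        refine hx.trans_lt ?_
        rw [div_lt_iff₀ hq]
        have := Nat.lt_mul_div_succ N (h.den_pos K)
        rw [mul_comm]
        exact_mod_cast this
      have h6 := one_le_sum_Icc_inv_filter hT hx'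
      have h7 : ∑ j ∈ Icc 1 (N / q K) with c / N ≤ (j : ℕ) * e, 1 / ((j : ℕ) * e) =
          1 / e * ∑ j ∈ Icc 1 (N / q K) with c / (N * e) ≤ (j : ℕ), 1 / (j : ℝ) := by
        rw [mul_sum]
        refine sum_congr (filter_congr fun j _ => ?_) fun j _ => ?_
        · rw [← div_div, div_le_iff₀ hd0]
        · rw [one_div_mul_one_div, mul_comm]
      rw [h7]
      have h8 : (q (K + 1) : ℝ) ≤ 1 / e := by
        rw [le_div_iff₀ hd0]
        rwa [le_div_iff₀ hq', mul_comm] at hd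
      have h9 : 0 ≤ L * N := by positivity
      nlinarith
  rw [abs_le] at h1
  nlinarith

end IsConvergentSeq

/-! ### Partial summation and the tail of `∑ 1/j²` -/

theorem inv_succ_le_log_succ_sub_log {n : ℕ} (hn : 1 ≤ n) :
    1 / ((n : ℝ) + 1) ≤ Real.log (n + 1 : ℕ) - Real.log n ∧
      Real.log (n + 1 : ℕ) - Real.log n ≤ 1 / n := by
  have hn' : (0 : ℝ) < n := by exact_mod_cast hn
  push_cast
  rw [← Real.log_div (by positivity) (by positivity)]
  constructor
  · have := Real.one_sub_inv_le_log_of_pos (x := ((n : ℝ) + 1) / n) (by positivity)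
    refine le_trans (le_of_eq ?_) this
    field_simp
    ring
  · have := Real.log_le_sub_one_of_pos (x := ((n : ℝ) + 1) / n) (by positivity)
    refine this.trans (le_of_eq ?_)
    field_simp
    ring

theorem log_succ_le_self (n : ℕ) : Real.log (n + 1 : ℕ) ≤ n := by
  have := Real.log_le_sub_one_of_pos (x := ((n + 1 : ℕ) : ℝ)) (by positivity)
  push_cast at *
  linarith

theorem sum_Ioc_div_eq {f : ℕ → ℝ} {M N : ℕ} (hMN : M ≤ N) :
    ∑ n ∈ Ioc M N, f n / n = (∑ m ∈ Icc 1 N, f m) / (N + 1) - (∑ m ∈ Icc 1 M, f m) / (M + 1)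
      + ∑ n ∈ Ioc M N, (∑ m ∈ Icc 1 n, f m) / (n * (n + 1)) := by
  induction N, hMN using Nat.le_induction with
  | base => simp
  | succ n hn ih =>
    rw [sum_Ioc_succ_top (by omega), sum_Ioc_succ_top (by omega), ih,
      sum_Icc_succ_top (by omega)]
    push_cast
    have : (n : ℝ) + 1 ≠ 0 := by positivity
    have : (n : ℝ) + 1 + 1 ≠ 0 := by positivity
    field_simp
    ring

/-- If `∑ m ≤ n, f m = n log n + O(B n)`, then partial summation gives
`∑ M < n ≤ N, f n / n = (log N) ^ 2 / 2 - (log M) ^ 2 / 2 + O(B (1 + log (N / M)))`. -/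
theorem abs_sum_Ioc_div_sub_le {f : ℕ → ℝ} {M N : ℕ} {B : ℝ} (hM : 1 ≤ M) (hMN : M ≤ N)
    (hB : 1 ≤ B)
    (hf : ∀ n, M ≤ n → n ≤ N → |∑ m ∈ Icc 1 n, f m - n * Real.log n| ≤ B * n) :
    |∑ n ∈ Ioc M N, f n / n - (1 / 2 * Real.log N ^ 2 - 1 / 2 * Real.log M ^ 2)|
      ≤ 4 * B * (1 + (Real.log N - Real.log M)) := by
  have hsum : ∀ N', M ≤ N' → N' ≤ N →
      |∑ n ∈ Ioc M N', (∑ m ∈ Icc 1 n, f m) / (n * (n + 1)) -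
        (1 / 2 * Real.log N' ^ 2 - 1 / 2 * Real.log M ^ 2)| ≤
        (B + 2) * (Real.log N' - Real.log M) := by
    intro N' hN'
    induction N', hN' using Nat.le_induction with
    | base => simp
    | succ n hn ih =>
      intro hnN
      have h1 := ih (by omega)
      have h2 := hf (n + 1) (by omega) hnN
      obtain ⟨h3, h4⟩ := inv_succ_le_log_succ_sub_log (hM.trans hn)
      have h5 := log_succ_le_self n
      have hn' : (1 : ℝ) ≤ n := by exact_mod_cast hM.trans hn
      rw [sum_Ioc_succ_top (by omega)]
      set x := Real.log (n + 1 : ℕ) with hx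
      set y := Real.log n with hy
      set s := ∑ m ∈ Icc 1 (n + 1), f m with hs
      have hx0 : 0 ≤ x := Real.log_natCast_nonneg _
      have hl1 : x - y ≤ 1 := h4.trans (by rw [div_le_one (by linarith)]; exact hn')
      have hl0 : 0 ≤ x - y := le_trans (by positivity) h3
      have h6 : |s / (((n + 1 : ℕ) : ℝ) * ((n + 1 : ℕ) + 1)) - x / (n + 2)| ≤ B * (x - y) := by
        have h7 : s / (((n + 1 : ℕ) : ℝ) * ((n + 1 : ℕ) + 1)) - x / (n + 2) =
            (s - (n + 1 : ℕ) * x) / ((n + 1) * (n + 2)) := by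
          push_cast
          field_simp
          ring
        rw [h7, abs_div, abs_of_pos (a := ((n : ℝ) + 1) * (n + 2)) (by positivity)]
        calc _ ≤ B * (n + 1 : ℕ) / (((n : ℝ) + 1) * (n + 2)) := by gcongr
          _ = B * (1 / (n + 2)) := by push_cast; field_simp
          _ ≤ B * (1 / (n + 1)) := by gcongr; linarith
          _ ≤ _ := by gcongr
      -- The term `x/(n+2)` is compared with `(x² - y²)/2 = x(x - y) - (x - y)²/2`, where `x - y` is
      -- close to `1/n`.
      have h8 : |x / (n + 2) - 1 / 2 * (x ^ 2 - y ^ 2)| ≤ 2 * (x - y) := by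
        rw [abs_le]
        constructor
        · have h9 : x * (1 / n) - x / (n + 2) ≤ 2 * (1 / (n + 1)) := by
            have : x * (1 / n) - x / (n + 2) = x * (2 / (n * (n + 2))) := by field_simp; ring
            rw [this]
            calc _ ≤ (n : ℝ) * (2 / (n * (n + 2))) := by gcongr
              _ = 2 * (1 / (n + 2)) := by field_simp
              _ ≤ _ := by gcongr; linarith
          have h10 : x * (x - y) ≤ x * (1 / n) := by gcongr
          nlinarith
        · have h9 : x / (n + 2) ≤ x * (x - y) := by
            calc x / (n + 2) ≤ x / (n + 1) := by gcongr; linarith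
              _ = x * (1 / (n + 1)) := by ring
              _ ≤ _ := by gcongr
          nlinarith
      rw [abs_le] at *
      constructor <;> nlinarith
  have hlog : ∀ n : ℕ, 0 ≤ Real.log n / (n + 1) ∧ Real.log n / (n + 1) ≤ 1 := by
    intro n
    refine ⟨div_nonneg (Real.log_natCast_nonneg _) (by positivity), ?_⟩
    rw [div_le_one (by positivity)]
    have := Real.log_le_self (Nat.cast_nonneg (α := ℝ) n)
    linarith
  have hbd : ∀ n : ℕ, M ≤ n → n ≤ N →
      |(∑ m ∈ Icc 1 n, f m) / (n + 1) - (Real.log n - Real.log n / (n + 1))| ≤ B := by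
    intro n h1 h2
    have h3 : (∑ m ∈ Icc 1 n, f m) / ((n : ℝ) + 1) - (Real.log n - Real.log n / (n + 1)) =
        (∑ m ∈ Icc 1 n, f m - n * Real.log n) / (n + 1) := by
      field_simp
      ring
    rw [h3, abs_div, abs_of_pos (a := (n : ℝ) + 1) (by positivity), div_le_iff₀ (by positivity)]
    exact (hf n h1 h2).trans (by nlinarith)
  have h1 := hsum N hMN le_rfl
  have h2 := hbd N hMN le_rfl
  have h3 := hbd M le_rfl hMN
  have h4 := hlog N
  have h5 := hlog M
  have h6 : Real.log M ≤ Real.log N :=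
    Real.log_le_log (by exact_mod_cast hM) (by exact_mod_cast hMN)
  rw [sum_Ioc_div_eq hMN]
  rw [abs_le] at *
  constructor <;> nlinarith

theorem sum_Icc_inv_sq_le (n : ℕ) : ∑ j ∈ Icc 1 n, 1 / (j : ℝ) ^ 2 ≤ Real.pi ^ 2 / 6 :=
  sum_le_hasSum _ (fun _ _ => by positivity) hasSum_zeta_two

theorem pi_sq_div_six_le_two : Real.pi ^ 2 / 6 ≤ 2 := by
  nlinarith [Real.pi_lt_d2, Real.pi_pos]

theorem pi_sq_div_six_sub_le {J : ℕ} (hJ : 1 ≤ J) :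
    Real.pi ^ 2 / 6 - 1 / (J : ℝ) ≤ ∑ j ∈ Icc 1 J, 1 / (j : ℝ) ^ 2 := by
  have h1 : ∀ n, J ≤ n → ∑ j ∈ range (n + 1), 1 / (j : ℝ) ^ 2 ≤
      ∑ j ∈ Icc 1 J, 1 / (j : ℝ) ^ 2 + 1 / (J : ℝ) - 1 / (n : ℝ) := by
    intro n hn
    induction n, hn using Nat.le_induction with
    | base =>
      rw [range_eq_Ico, sum_eq_sum_Ico_succ_bot (by omega)]
      have : Ico (0 + 1) (J + 1) = Icc 1 J := by ext; simp
      rw [this]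
      simp
    | succ n hn ih =>
      rw [sum_range_succ]
      have hn' : (0 : ℝ) < n := by exact_mod_cast hJ.trans hn
      have h2 : 1 / ((n + 1 : ℕ) : ℝ) ^ 2 ≤ 1 / n - 1 / (n + 1 : ℕ) := by
        have : (1 : ℝ) / n - 1 / (n + 1 : ℕ) = 1 / (n * (n + 1 : ℕ)) := by
          push_cast; field_simp; ring
        rw [this]
        apply one_div_le_one_div_of_le (by positivity)
        push_cast
        nlinarith
      linarith
  have h2 := (Filter.tendsto_add_atTop_iff_nat 1).2 hasSum_zeta_two.tendsto_sum_nat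
  have h3 : Real.pi ^ 2 / 6 ≤ ∑ j ∈ Icc 1 J, 1 / (j : ℝ) ^ 2 + 1 / J := by
    refine le_of_tendsto h2 ?_
    filter_upwards [Filter.eventually_ge_atTop J] with n hn
    have h4 := h1 n hn
    have : (0 : ℝ) ≤ 1 / (n : ℝ) := by positivity
    linarith
  linarith

/-! ### The weighted sum -/

namespace IsConvergentSeq

variable {α : ℝ} {a q : ℕ → ℕ} {p : ℕ → ℤ}

/-- For even `K` the multiples of `q_K` are left out. -/
theorem abs_sum_not_dvd_sub_le (h : IsConvergentSeq α a q p) {K N : ℕ} (hN : q K ≤ N)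
    (hN' : N < q (K + 1)) :
    |∑ n ∈ Icc 1 N, (if Even K ∧ q K ∣ n then 0 else 1 / Int.fract ((n : ℕ) * α))
      - N * Real.log N| ≤ 41 * errLog (quotSum a (K + 1)) * N := by
  have h1 := h.abs_sum_one_le_mul_fract_sub_le hN hN'
  have hL := one_le_errLog (quotSum a (K + 1))
  have hN0 : (0 : ℝ) ≤ errLog (quotSum a (K + 1)) * N := by positivity
  rcases Nat.even_or_odd K with hK | hK
  · have h2 : ∑ n ∈ Icc 1 N, (if Even K ∧ q K ∣ n then 0 else 1 / Int.fract ((n : ℕ) * α)) =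
        ∑ n ∈ Icc 1 N with 1 ≤ q K * Int.fract ((n : ℕ) * α), 1 / Int.fract ((n : ℕ) * α) := by
      rw [sum_filter]
      refine sum_congr rfl fun n hn => ?_
      have h3 := h.mul_fract_lt_one_iff_of_even hK ((mem_Icc.1 hn).2.trans_lt hN')
      by_cases h4 : q K ∣ n
      · rw [if_pos ⟨hK, h4⟩, if_neg (not_le.2 (h3.2 h4))]
      · rw [if_neg (by tauto), if_pos (not_lt.1 (mt h3.1 h4))]
    rw [h2]
    exact h1.trans (by linarith)
  · have h2 := h.sum_mul_fract_lt_one_le_of_odd hK hN hN'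
    have h3 : 0 ≤ ∑ n ∈ Icc 1 N with q K * Int.fract ((n : ℕ) * α) < 1,
        1 / Int.fract ((n : ℕ) * α) :=
      sum_nonneg fun n _ => div_nonneg zero_le_one (Int.fract_nonneg _)
    simp only [Nat.not_even_iff_odd.2 hK, false_and, if_false]
    rw [← sum_filter_add_sum_filter_not (Icc 1 N)
      (fun n : ℕ => 1 ≤ q K * Int.fract ((n : ℕ) * α))]
    simp only [not_le]
    rw [abs_le] at *
    constructor <;> linarith

/-- Handles the left endpoint `n = q_K`, which partial summation over `(q_K, N]` misses. Here `{q_K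
α} = 1 - e ≥ 1/2`. -/
theorem inv_den_mul_fract_le_of_odd (h : IsConvergentSeq α a q p) {K : ℕ} (hK : Odd K)
    (hq' : 1 < q (K + 1)) : 1 / Int.fract ((q K : ℝ) * α) / q K ≤ 2 := by
  have h1 := h.dist_le K
  have h2 := h.dist_pos K
  rw [hK.neg_one_pow] at h1 h2
  have hq : (1 : ℝ) ≤ q K := by exact_mod_cast h.den_pos K
  have hq2 : (2 : ℝ) ≤ q (K + 1) := by exact_mod_cast hq'
  have h3 : 1 / (q (K + 1) : ℝ) ≤ 1 / 2 := one_div_le_one_div_of_le (by norm_num) hq2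
  have h4 : Int.fract ((q K : ℝ) * α) = 1 - (p K - q K * α) := by
    rw [Int.fract_eq_iff]
    refine ⟨by linarith, by linarith, p K - 1, ?_⟩
    push_cast
    ring
  rw [h4, div_div, div_le_iff₀ (by nlinarith)]
  nlinarith

/-- At `n = j q_K` the weighted term is `1/(q_K e j²)`, and `1/(q_K e)` exceeds `a_{K+1}` by at most
`2`. -/
theorem abs_sum_dvd_sub_le (h : IsConvergentSeq α a q p) {K N : ℕ} (hK : Even K)
    (hN' : N < q (K + 1)) :
    |∑ n ∈ Icc 1 N with q K ∣ n, 1 / Int.fract ((n : ℕ) * α) / n -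
      a (K + 1) * ∑ j ∈ Icc 1 (N / q K), 1 / (j : ℝ) ^ 2| ≤ 4 := by
  have h2 := h.dist_pos K
  rw [hK.neg_one_pow, one_mul] at h2
  obtain ⟨h3, h4⟩ := h.inv_dist_div_den_le hK
  have hq : (0 : ℝ) < q K := by exact_mod_cast h.den_pos K
  have e1 : ∑ n ∈ Icc 1 N with q K ∣ n, 1 / Int.fract ((n : ℕ) * α) / n =
      1 / (q K * (q K * α - p K)) * ∑ j ∈ Icc 1 (N / q K), 1 / (j : ℝ) ^ 2 := by
    rw [sum_Icc_filter_dvd _ (h.den_pos K), mul_sum]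
    refine sum_congr rfl fun j hj => ?_
    have h1 : q K * j < q (K + 1) :=
      ((Nat.mul_le_mul_left _ (mem_Icc.1 hj).2).trans (Nat.mul_div_le N (q K))).trans_lt hN'
    have hj0 : (0 : ℝ) < j := by exact_mod_cast (mem_Icc.1 hj).1
    rw [(h.fract_mul_den_of_even hK h1).1]
    push_cast
    rw [div_div, one_div_mul_one_div]
    congr 1
    ring
  have h5 := (sum_Icc_inv_sq_le (N / q K)).trans pi_sq_div_six_le_two
  have h6 : 0 ≤ ∑ j ∈ Icc 1 (N / q K), 1 / (j : ℝ) ^ 2 := sum_nonneg fun _ _ => by positivity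
  rw [e1, ← sub_mul, abs_mul, abs_of_nonneg h6, abs_of_nonneg (by linarith)]
  calc _ ≤ (2 : ℝ) * 2 := by gcongr; linarith
    _ = 4 := by norm_num

theorem abs_sum_Icc_den_sub_le (h : IsConvergentSeq α a q p) {K N : ℕ} (hN : q K ≤ N)
    (hN' : N < q (K + 1)) :
    |∑ n ∈ Icc (q K) N, 1 / ((n : ℝ) * Int.fract ((n : ℕ) * α)) -
      (1 / 2 * Real.log N ^ 2 - 1 / 2 * Real.log (q K) ^ 2 +
        if Odd (K + 1) then (a (K + 1) : ℝ) * ∑ j ∈ Icc 1 (N / q K), 1 / (j : ℝ) ^ 2 else 0)| ≤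
      170 * errLog (quotSum a (K + 1)) * (1 + (Real.log N - Real.log (q K))) := by
  have hL := one_le_errLog (quotSum a (K + 1))
  have hq := h.den_pos K
  set G : ℕ → ℝ := fun n => if Even K ∧ q K ∣ n then 0 else 1 / Int.fract ((n : ℕ) * α) with hG
  have h1 := abs_sum_Ioc_div_sub_le (f := G) (M := q K) (N := N)
    (B := 41 * errLog (quotSum a (K + 1))) hq hN (by linarith)
    (fun n h1 h2 => h.abs_sum_not_dvd_sub_le h1 (h2.trans_lt hN'))
  have h2 : |G (q K) / q K| ≤ 2 := by
    rcases Nat.even_or_odd K with hK | hK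
    · simp [hG, hK]
    · simp only [hG, Nat.not_even_iff_odd.2 hK, false_and, if_false]
      rw [abs_of_nonneg (div_nonneg (div_nonneg zero_le_one (Int.fract_nonneg _)) (by positivity))]
      exact h.inv_den_mul_fract_le_of_odd hK (by omega)
  have h3 : ∑ n ∈ Icc (q K) N, 1 / ((n : ℝ) * Int.fract ((n : ℕ) * α)) =
      ∑ n ∈ Icc (q K) N, G n / n + if Odd (K + 1) then
        ∑ n ∈ Icc 1 N with q K ∣ n, 1 / Int.fract ((n : ℕ) * α) / n else 0 := by
    have h4 : ∀ n : ℕ, 1 / ((n : ℝ) * Int.fract ((n : ℕ) * α)) =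
        1 / Int.fract ((n : ℕ) * α) / n := fun n => by rw [div_div, mul_comm]
    simp only [h4]
    rcases Nat.even_or_odd K with hK | hK
    · rw [if_pos hK.add_one, ← sum_filter_add_sum_filter_not (Icc (q K) N) (fun n => q K ∣ n),
        add_comm]
      congr 1
      · rw [sum_filter]
        refine sum_congr rfl fun n _ => ?_
        by_cases hn : q K ∣ n <;> simp [hG, hK, hn]
      · refine sum_congr ?_ fun _ _ => rfl
        ext n
        simp only [mem_filter, mem_Icc]
        constructor
        · rintro ⟨h5, h6⟩
          exact ⟨⟨by omega, h5.2⟩, h6⟩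
        · rintro ⟨h5, h6⟩
          exact ⟨⟨Nat.le_of_dvd (by omega) h6, h5.2⟩, h6⟩
    · rw [if_neg (by rw [Nat.not_odd_iff_even]; exact hK.add_one), add_zero]
      simp only [hG, Nat.not_even_iff_odd.2 hK, false_and, if_false]
  have h4 : ∑ n ∈ Icc (q K) N, G n / n = G (q K) / q K + ∑ n ∈ Ioc (q K) N, G n / n := by
    rw [← Ioc_insert_left hN, sum_insert (by simp)]
  have h5 : |(if Odd (K + 1) then
        ∑ n ∈ Icc 1 N with q K ∣ n, 1 / Int.fract ((n : ℕ) * α) / n else 0) -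
      (if Odd (K + 1) then (a (K + 1) : ℝ) * ∑ j ∈ Icc 1 (N / q K), 1 / (j : ℝ) ^ 2 else 0)| ≤ 4 := by
    split_ifs with hK
    · rw [Nat.odd_add_one, Nat.not_odd_iff_even] at hK
      exact h.abs_sum_dvd_sub_le hK hN'
    · simp
  have h6 : Real.log (q K) ≤ Real.log N :=
    Real.log_le_log (by exact_mod_cast hq) (by exact_mod_cast hN)
  rw [h3, h4]
  have h7 : 0 ≤ (errLog (quotSum a (K + 1)) - 1) * (1 + (Real.log N - Real.log (q K))) :=
    mul_nonneg (by linarith) (by linarith)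
  rw [abs_le] at *
  constructor <;> linarith

/-- Sums the complete blocks: each costs a multiple of `log s` times `1 + log(q_{k+1}/q_k)`, and the
logarithms telescope. -/
theorem abs_sum_Ico_den_sub_le (h : IsConvergentSeq α a q p) (K : ℕ) :
    |∑ n ∈ Ico 1 (q K), 1 / ((n : ℝ) * Int.fract ((n : ℕ) * α)) -
      (1 / 2 * Real.log (q K) ^ 2 +
        Real.pi ^ 2 / 6 * ∑ k ∈ Icc 1 K with Odd k, (a k : ℝ))| ≤
      173 * errLog (quotSum a K) * (K + Real.log (q K)) := by
  induction K with
  | zero => simp [h.den_zero]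
  | succ K ih =>
    have hL := one_le_errLog (quotSum a (K + 1))
    have hmono : errLog (quotSum a K) ≤ errLog (quotSum a (K + 1)) :=
      errLog_mono (by exact_mod_cast quotSum_mono a (Nat.le_succ K))
    have hlogq : 0 ≤ Real.log (q K) := Real.log_natCast_nonneg _
    have hpi := pi_sq_div_six_le_two
    have ih' : |∑ n ∈ Ico 1 (q K), 1 / ((n : ℝ) * Int.fract ((n : ℕ) * α)) -
        (1 / 2 * Real.log (q K) ^ 2 +
          Real.pi ^ 2 / 6 * ∑ k ∈ Icc 1 K with Odd k, (a k : ℝ))| ≤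
        173 * errLog (quotSum a (K + 1)) * (K + Real.log (q K)) := ih.trans (by gcongr)
    have hodd : ∑ k ∈ Icc 1 (K + 1) with Odd k, (a k : ℝ) =
        ∑ k ∈ Icc 1 K with Odd k, (a k : ℝ) + if Odd (K + 1) then (a (K + 1) : ℝ) else 0 := by
      rw [sum_filter, sum_Icc_succ_top (by omega), ← sum_filter]
    rw [hodd]
    set R := ∑ k ∈ Icc 1 K with Odd k, (a k : ℝ) with hR
    set L := errLog (quotSum a (K + 1)) with hLdef
    -- A block can be empty: `q_0 = q_1 = 1` when `a_1 = 1`.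
    rcases (h.den_le_succ K).eq_or_lt with hq | hq
    · rw [← hq]
      have ha : a (K + 1) = 1 := by
        have h1 := h.quot_mul_den_le K
        have h2 := h.one_le_quot K
        have h3 := h.den_pos K
        rw [← hq] at h1
        nlinarith
      have h4 : |Real.pi ^ 2 / 6 * (if Odd (K + 1) then (a (K + 1) : ℝ) else 0)| ≤ 2 := by
        rw [ha]
        split_ifs
        · rw [abs_of_nonneg (by positivity)]; simpa using hpi
        · simp
      rw [abs_le] at *
      push_cast
      constructor <;> nlinarith
    · obtain ⟨N, hN⟩ : ∃ N, q (K + 1) = N + 1 := ⟨q (K + 1) - 1, by omega⟩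
      have hKN : q K ≤ N := by omega
      have hN1 : 1 ≤ N := (h.den_pos K).trans_le hKN
      have h1 := h.abs_sum_Icc_den_sub_le hKN (by omega)
      have h2 : ∑ n ∈ Ico 1 (q (K + 1)), 1 / ((n : ℝ) * Int.fract ((n : ℕ) * α)) =
          ∑ n ∈ Ico 1 (q K), 1 / ((n : ℝ) * Int.fract ((n : ℕ) * α)) +
            ∑ n ∈ Icc (q K) N, 1 / ((n : ℝ) * Int.fract ((n : ℕ) * α)) := by
        rw [← sum_Ico_consecutive _ (h.den_pos K) (h.den_le_succ K), hN]
        congr 1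
      -- Completing the sum of `1/j²` costs at most `a_{K+1}/J` with `J = ⌊N/q_K⌋`. This is at most
      -- `2`, as `J ≥ 1` and `J ≥ a_{K+1} - 1`.
      have h3 : |Real.pi ^ 2 / 6 * (if Odd (K + 1) then (a (K + 1) : ℝ) else 0) -
          (if Odd (K + 1) then (a (K + 1) : ℝ) * ∑ j ∈ Icc 1 (N / q K), 1 / (j : ℝ) ^ 2 else 0)| ≤ 2 := by
        split_ifs with hK
        · have hJ : 1 ≤ N / q K := (Nat.le_div_iff_mul_le (h.den_pos K)).2 (by omega)
          have haJ : a (K + 1) ≤ 2 * (N / q K) := by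
            have h4 := h.quot_mul_den_le K
            have h5 : a (K + 1) - 1 ≤ N / q K := by
              rw [Nat.le_div_iff_mul_le (h.den_pos K), Nat.sub_mul]
              have := h.den_pos K
              omega
            omega
          have haJ' : (a (K + 1) : ℝ) ≤ 2 * (N / q K : ℕ) := by exact_mod_cast haJ
          have hJ' : (0 : ℝ) < (N / q K : ℕ) := by exact_mod_cast hJ
          have h6 := sum_Icc_inv_sq_le (N / q K)
          have h7 := pi_sq_div_six_sub_le hJ
          have h8 : Real.pi ^ 2 / 6 * (a (K + 1) : ℝ) -
              a (K + 1) * ∑ j ∈ Icc 1 (N / q K), 1 / (j : ℝ) ^ 2 =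
              a (K + 1) * (Real.pi ^ 2 / 6 - ∑ j ∈ Icc 1 (N / q K), 1 / (j : ℝ) ^ 2) := by ring
          rw [h8, abs_of_nonneg (mul_nonneg (Nat.cast_nonneg _) (by linarith))]
          calc _ ≤ (2 * (N / q K : ℕ) : ℝ) * (1 / (N / q K : ℕ)) := by
                gcongr
                · linarith
            _ = 2 := by field_simp
        · simp
      have h4 := (inv_succ_le_log_succ_sub_log hN1)
      have h5 := log_succ_le_self N
      rw [h2, hN]
      have hN' : (1 : ℝ) ≤ N := by exact_mod_cast hN1
      set x := Real.log (N + 1 : ℕ) with hx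
      set y := Real.log N with hy
      have hxy : 0 ≤ x - y := le_trans (by positivity) h4.1
      have hy0 : 0 ≤ y := Real.log_natCast_nonneg _
      have h6 : 0 ≤ 1 / 2 * x ^ 2 - 1 / 2 * y ^ 2 := by nlinarith
      have h7 : 1 / 2 * x ^ 2 - 1 / 2 * y ^ 2 ≤ 1 := by
        have h8 : x * (x - y) ≤ N * (1 / N) := by
          gcongr
          exact h4.2
        have h9 : (N : ℝ) * (1 / N) = 1 := by field_simp
        nlinarith
      have h8 : Real.log (q K) ≤ y :=
        Real.log_le_log (by exact_mod_cast h.den_pos K) (by exact_mod_cast hKN)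
      have h9 : 170 * L * (1 + (y - Real.log (q K))) ≤ 170 * L * (1 + (x - Real.log (q K))) := by
        gcongr
        linarith
      have h10 : 0 ≤ L * (x - Real.log (q K)) := mul_nonneg (by linarith) (by linarith)
      push_cast
      rw [abs_le] at *
      constructor <;> linarith

/-- The product `q_k q_{k+1}` at least doubles at each step, since `q_{k+2} ≥ q_k + q_{k+1} ≥ 2q_k`.
This bounds the number of blocks by a logarithm. -/
theorem le_log_den (h : IsConvergentSeq α a q p) (K : ℕ) :
    (K : ℝ) ≤ 1 + 4 * Real.log (q K) := by
  have h1 : ∀ k, 2 ^ k ≤ q k * q (k + 1) := by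
    intro k
    induction k with
    | zero => exact Nat.mul_pos (h.den_pos 0) (h.den_pos 1)
    | succ k ih =>
      have h2 := h.den_add_le k
      have h3 := h.den_le_succ k
      rw [pow_succ]
      nlinarith
  cases K with
  | zero => simp [h.den_zero]
  | succ k =>
    have h2 : 2 ^ k ≤ q (k + 1) ^ 2 := by
      rw [sq]
      exact (h1 k).trans (Nat.mul_le_mul_right _ (h.den_le_succ k))
    have h3 : Real.log ((2 : ℝ) ^ k) ≤ Real.log ((q (k + 1) : ℝ) ^ 2) :=
      Real.log_le_log (by positivity) (by exact_mod_cast h2)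
    rw [Real.log_pow, Real.log_pow] at h3
    have h4 := Real.log_two_gt_d9
    push_cast at *
    nlinarith [(Nat.cast_nonneg k : (0 : ℝ) ≤ k)]

theorem abs_weightedFractSum_sub_le (h : IsConvergentSeq α a q p) {K N : ℕ} (hN : q K ≤ N)
    (hN' : N < q (K + 1)) :
    |weightedFractSum α N - (1 / 2 * Real.log N ^ 2 +
      Real.pi ^ 2 / 6 * ∑ k ∈ Icc 1 K with Odd k, (a k : ℝ) +
        if Odd (K + 1) then (a (K + 1) : ℝ) * ∑ j ∈ Icc 1 (N / q K), 1 / (j : ℝ) ^ 2 else 0)| ≤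
      1211 * (errLog (quotSum a (K + 1)) * errLog N) := by
  have hL := one_le_errLog (quotSum a (K + 1))
  have hmono : errLog (quotSum a K) ≤ errLog (quotSum a (K + 1)) :=
    errLog_mono (by exact_mod_cast quotSum_mono a (Nat.le_succ K))
  have hlogq : 0 ≤ Real.log (q K) := Real.log_natCast_nonneg _
  have hq : (0 : ℝ) < q K := by exact_mod_cast h.den_pos K
  have hqN : (q K : ℝ) ≤ N := by exact_mod_cast hN
  have hqlog : Real.log (q K) ≤ Real.log N := Real.log_le_log hq hqN
  have h1 := (h.abs_sum_Ico_den_sub_le K).trans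
    (mul_le_mul_of_nonneg_right (mul_le_mul_of_nonneg_left hmono (by norm_num)) (by positivity))
  have h2 := h.abs_sum_Icc_den_sub_le hN hN'
  have h3 : weightedFractSum α N = ∑ n ∈ Ico 1 (q K), 1 / ((n : ℝ) * Int.fract ((n : ℕ) * α)) +
      ∑ n ∈ Icc (q K) N, 1 / ((n : ℝ) * Int.fract ((n : ℕ) * α)) := by
    have h4 := sum_Ico_consecutive (fun n : ℕ => 1 / ((n : ℝ) * Int.fract ((n : ℕ) * α)))
      (h.den_pos K) (Nat.le_succ_of_le hN)
    exact h4.symm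
  have h4 := h.le_log_den K
  have h5 := one_le_errLog N
  have h6 := log_le_errLog (hq.trans_le hqN)
  rw [h3]
  set L := errLog (quotSum a (K + 1)) with hLdef
  have h7 : 173 * L * (K + Real.log (q K)) + 170 * L * (1 + (Real.log N - Real.log (q K))) ≤
      1211 * (L * errLog N) := by
    have h8 : 173 * (K + Real.log (q K)) + 170 * (1 + (Real.log N - Real.log (q K))) ≤
        1211 * errLog N := by linarith
    nlinarith
  rw [abs_le] at *
  constructor <;> linarith

end IsConvergentSeq

/-! ### The theorem -/

theorem theorem5 :
    (∀ c : ℝ, 0 < c → ∃ C : ℝ, 0 < C ∧ ∀ α : ℝ, Irrational α → ∀ K N : ℕ,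
      convergentDen α K ≤ (N : ℝ) → (N : ℝ) < convergentDen α (K + 1) →
        |fractSum c α N - (N : ℝ) * Real.log N| ≤
          C * (((if Odd (K + 1) then √(partialQuotient α (K + 1)) else 0)
            + errLog (partialQuotientSum α (K + 1))) * (N : ℝ))) ∧
    (∀ c : ℝ, 0 < c → ∃ C : ℝ, 0 < C ∧ ∀ α : ℝ, Irrational α → ∀ K N : ℕ,
      convergentDen α K ≤ (N : ℝ) → (N : ℝ) < convergentDen α (K + 1) →
      4 * √(c * partialQuotient α (K + 1)) * convergentDen α K ≤ (N : ℝ) → Odd (K + 1) →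
        (N : ℝ) * Real.log N + convergentDen α (K + 1)
          - C * (errLog (partialQuotientSum α (K + 1)) * (N : ℝ)) ≤ fractSum c α N) ∧
    (∃ C : ℝ, 0 < C ∧ ∀ α : ℝ, Irrational α → ∀ K N : ℕ,
      convergentDen α K ≤ (N : ℝ) → (N : ℝ) < convergentDen α (K + 1) →
        |weightedFractSum α N
          - ((1 / 2) * (Real.log N) ^ 2
            + (Real.pi ^ 2 / 6) * ∑ k ∈ (Finset.Icc 1 K).filter (fun k => Odd k),
                partialQuotient α k
            + (if Odd (K + 1) then
                partialQuotient α (K + 1)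
                  * ∑ j ∈ Finset.Icc 1 ⌊(N : ℝ) / convergentDen α K⌋₊, 1 / (j : ℝ) ^ 2
              else 0))| ≤
          C * ((∑ k ∈ (Finset.Icc 1 (K + 1)).filter (fun k => Odd k),
                √(partialQuotient α k) * errLog (partialQuotient α k))
            + errLog (partialQuotientSum α (K + 1)) * errLog N)) := by
  have hsum : ∀ {α : ℝ} {a : ℕ → ℕ}, (∀ k, partialQuotient α (k + 1) = a (k + 1)) →
      ∀ K, partialQuotientSum α K = quotSum a K := by
    intro α a hpa K
    unfold partialQuotientSum quotSum
    push_cast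
    refine sum_congr rfl fun k hk => ?_
    obtain ⟨k, rfl⟩ := Nat.exists_eq_succ_of_ne_zero (by have := (mem_Icc.1 hk).1; omega : k ≠ 0)
    exact hpa k
  refine ⟨fun c hc => ⟨45 + 2 * c + 4 / √c, by positivity, ?_⟩,
    fun c hc => ⟨35 + 2 * c, by positivity, ?_⟩, 1211, by norm_num, ?_⟩
  · intro α hα K N hN hN'
    obtain ⟨a, q, p, h, hq, hpa⟩ := exists_isConvergentSeq hα
    rw [hq, Nat.cast_le] at hN
    rw [hq, Nat.cast_lt] at hN'
    rw [hpa, hsum hpa]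
    exact h.abs_fractSum_sub_log_le hN hN' hc
  · intro α hα K N hN hN' hcN hK
    obtain ⟨a, q, p, h, hq, hpa⟩ := exists_isConvergentSeq hα
    rw [hq, Nat.cast_le] at hN
    rw [hq, Nat.cast_lt] at hN'
    rw [hpa, hq] at hcN
    rw [hq, hsum hpa]
    exact h.le_fractSum hN hN' hc hcN hK
  · intro α hα K N hN hN'
    obtain ⟨a, q, p, h, hq, hpa⟩ := exists_isConvergentSeq hα
    rw [hq, Nat.cast_le] at hN
    rw [hq, Nat.cast_lt] at hN'
    have hodd : ∑ k ∈ Icc 1 K with Odd k, partialQuotient α k =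
        ∑ k ∈ Icc 1 K with Odd k, (a k : ℝ) := by
      refine sum_congr rfl fun k hk => ?_
      obtain ⟨k, rfl⟩ := Nat.exists_eq_succ_of_ne_zero
        (by have := (mem_Icc.1 (mem_filter.1 hk).1).1; omega : k ≠ 0)
      exact hpa k
    rw [hpa, hq, hsum hpa, hodd, Nat.floor_div_eq_div]
    refine (h.abs_weightedFractSum_sub_le hN hN').trans ?_
    gcongr
    -- The error proved is already `O(log s_{K+1} log N)`: no cutoff enters the weighted sum, so the
    -- terms `√a_k log a_k` are only nonnegative slack.
    refine le_add_of_nonneg_left (sum_nonneg fun k _ => ?_)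
    exact mul_nonneg (Real.sqrt_nonneg _) (zero_le_one.trans (one_le_errLog _))
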